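/- Let $d\in\mathbb N$ and let $\phi$ be a continuous probability density (with respect to Lebesgue measure) on the space $M_{d\times d}(\mathbb R)$ of real $d\times d$ matrices such that, for some $C>0$, $\phi(A)\le C/\|A\|^{d^2+1}$ for all $A\neq 0$, where $\|\cdot\|$ is the operator norm. Then there is a constant $C_\phi>0$, depending only on $\phi$ (and $d$), with the following property. Let $M\ge 1$, $0<\epsilon\le 1$, let $A$ be any $d\times d$ matrix with $\|A\|\le M$, let $E$ be a random matrix with density $\phi$, and let $\mu_\epsilon$ be the law of $A+\epsilon E$. Then, for every $1\le k<d$, $\mu_\epsilon$ is carried by the invertible matrices and, acting on the bundle of miniflags $\operatorname{PF}(k-1,k,k+1)\to\operatorname{PF}(k-1,k+1)$, it has uniform fiberwise push-forward entropy at least $C_\phi\,\epsilon^2/M^2$; that is, $$\inf_{F\in \operatorname{PF}(k-1,k+1)} h_{\mathrm{FA}}(F,\mu_\epsilon)\ \ge\ \frac{C_\phi\,\epsilon^2}{M^2}.$$ Here $\operatorname{PF}(k-1,k+1)$ is the space of pairs $F=(V_{k-1}\subset V_{k+1})$ of linear subspaces of $\mathbb R^d$ with $\dim V_i=i$, and the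 fiber (miniflag) $\mathcal F(F)$ over $F$ is the set of all $k$-dimensional $V_k$ with $V_{k-1}\subset V_k\subset V_{k+1}$; an invertible matrix $B$ maps $\mathcal F(F)$ onto $\mathcal F(BF)$ by $V_k\mapsto BV_k$. For a probability measure $\mu$ on matrices that is carried by the invertible ones, let $\bar\mu_F$ be the law of $BF$ when $B$ has law $\mu$, and let $\mu_{F,F'}$ be the conditional law of $B$ given $BF=F'$. Then $$h_{\mathrm{FA}}(F,\mu)=\int h(\mu_{F,F'})\,d\bar\mu_F(F'),\qquad h(\mu_{F,F'})=\inf_\nu\int d_{\mathrm{KL}}\big(B_*\nu\,\big|\,\mu_{F,F'}*\nu\big)\,d\mu_{F,F'}(B),$$ where the infimum is over all Borel probability measures $\nu$ on $\mathcal F(F)$, $\mu_{F,F'}*\nu=\int B_*\nu\,d\mu_{F,F'}(B)$, and $d_{\mathrm{KL}}(\nu_1|\nu_2)=\int\log\frac{d\nu_1}{d\nu_2}\,d\nu_1$ if $\nu_1\ll\nu_2$ and $+\infty$ otherwise. -/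

import Mathlib

open MeasureTheory ProbabilityTheory
open scoped ENNReal

noncomputable section

/-! ### Entropy of random families of maps -/

section Entropy

variable {Ω X Y : Type*} [MeasurableSpace Ω] [MeasurableSpace X] [MeasurableSpace Y]

/-- The mean push-forward `μ * ν = ∫ (f_ω)_* ν dμ(ω)` of a measure `ν` on `X` under a random map
`f_ω : X → Y`, where `ω` has law `μ`. -/
def meanPushforward (μ : Measure Ω) (f : Ω → X → Y) (ν : Measure X) : Measure Y :=
  μ.bind fun ω => ν.map (f ω)

/-- The Furstenberg entropy `Φ_μ(ν) = ∫ d_KL((f_ω)_* ν | μ * ν) dμ(ω)`. -/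
def furstenbergEntropy (μ : Measure Ω) (f : Ω → X → Y) (ν : Measure X) : ℝ≥0∞ :=
  ∫⁻ ω, InformationTheory.klDiv (ν.map (f ω)) (meanPushforward μ f ν) ∂μ

/-- The push-forward entropy `h(μ)`: the infimum of `Φ_μ(ν)` over all probability measures `ν`
on the source space `X`. -/
def pushforwardEntropy (μ : Measure Ω) (f : Ω → X → Y) : ℝ≥0∞ :=
  ⨅ ν : ProbabilityMeasure X, furstenbergEntropy μ f (ν : Measure X)

end Entropy

/-! ### Matrices -/

/-- The space of real `d × d` matrices. -/
abbrev Mat (d : ℕ) : Type := Matrix (Fin d) (Fin d) ℝ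

instance (d : ℕ) : MeasurableSpace (Mat d) :=
  inferInstanceAs (MeasurableSpace (Fin d → Fin d → ℝ))

instance (d : ℕ) : BorelSpace (Mat d) :=
  inferInstanceAs (BorelSpace (Fin d → Fin d → ℝ))

instance (d : ℕ) : StandardBorelSpace (Mat d) :=
  inferInstanceAs (StandardBorelSpace (Fin d → Fin d → ℝ))

/-- Lebesgue measure on the space of matrices, with the entries as coordinates. -/
def matLebesgue (d : ℕ) : Measure (Mat d) :=
  (volume : Measure (Fin d → Fin d → ℝ)).map Matrix.of

/-- The operator norm of a matrix acting on Euclidean space. -/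
def opNorm {d : ℕ} (A : Mat d) : ℝ := ‖Matrix.toEuclideanCLM (n := Fin d) (𝕜 := ℝ) A‖

/-! ### Subspaces, partial flags and miniflags -/

/-- The set of all linear subspaces of `ℝ^d`, that is, the disjoint union of the Grassmannians
`Gr(k, d)` for `0 ≤ k ≤ d`. -/
abbrev Subsp (d : ℕ) : Type := Submodule ℝ (EuclideanSpace ℝ (Fin d))

/-- The usual topology of the Grassmannians: the subspace `V` is identified with the orthogonal
projection onto `V`. -/
instance (d : ℕ) : TopologicalSpace (Subsp d) :=
  TopologicalSpace.induced
    (fun V => (V.starProjection : EuclideanSpace ℝ (Fin d) →L[ℝ] EuclideanSpace ℝ (Fin d)))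
    inferInstance

instance (d : ℕ) : MeasurableSpace (Subsp d) := borel (Subsp d)

instance (d : ℕ) : BorelSpace (Subsp d) := ⟨rfl⟩

/-- The action of a matrix on subspaces, `V ↦ B V`. If `B` is invertible it preserves dimensions
and inclusions. -/
def actSubsp {d : ℕ} (B : Mat d) (V : Subsp d) : Subsp d :=
  V.map (Matrix.toEuclideanLin B)

/-- The space `PF(k-1, k+1)` of partial flags `V_{k-1} ⊆ V_{k+1} ⊆ ℝ^d` with
`dim V_{k-1} = k - 1` and `dim V_{k+1} = k + 1`. -/
def PF (d k : ℕ) : Set (Subsp d × Subsp d) :=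
  {F | F.1 ≤ F.2 ∧ Module.finrank ℝ F.1 + 1 = k ∧ Module.finrank ℝ F.2 = k + 1}

/-- The miniflag over the pair `F = (V_{k-1}, V_{k+1})`: all `k`-dimensional `V` with
`V_{k-1} ⊆ V ⊆ V_{k+1}`. It is the fibre over `F` of `PF(k-1, k, k+1) → PF(k-1, k+1)`. -/
def miniflag {d : ℕ} (k : ℕ) (F : Subsp d × Subsp d) : Set (Subsp d) :=
  {V | F.1 ≤ V ∧ V ≤ F.2 ∧ Module.finrank ℝ V = k}

/-- The action of a matrix on pairs of subspaces. An invertible matrix maps `PF(k-1, k+1)` to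
itself and the miniflag over `F` onto the miniflag over the image of `F`. -/
def actPair {d : ℕ} (F : Subsp d × Subsp d) (B : Mat d) : Subsp d × Subsp d :=
  (actSubsp B F.1, actSubsp B F.2)

/-- The map induced by a matrix on the miniflag over `F`. The target is taken to be the space of
all subspaces; for invertible `B` the image is the miniflag over `actPair F B`. -/
def actMiniflag {d : ℕ} (k : ℕ) (F : Subsp d × Subsp d) (B : Mat d) (V : miniflag k F) : Subsp d :=
  actSubsp B V

/-! ### Fibrewise entropy -/

/-- The conditional law `μ_{F, F'}` of a random matrix `B` with law `μ`, given that `B` carries the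
partial flag `F` to `F'`, as a Markov kernel in `F'` (regular conditional distribution; it is
determined up to a null set of the law of the image of `F`). -/
def condLaw {d : ℕ} (μ : Measure (Mat d)) [IsFiniteMeasure μ] (F : Subsp d × Subsp d) :
    Kernel (Subsp d × Subsp d) (Mat d) :=
  condDistrib (fun B : Mat d => B) (actPair F) μ

/-- The fibre-averaged push-forward entropy `h_FA(F, μ) = ∫ h(μ_{F, F'}) dμ̄_F(F')` of the
miniflag over `F`, where `μ̄_F` is the law of the image of `F`. -/
def fiberAveragedEntropy {d : ℕ} (k : ℕ) (μ : Measure (Mat d)) [IsFiniteMeasure μ]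
    (F : Subsp d × Subsp d) : ℝ≥0∞ :=
  ∫⁻ F', pushforwardEntropy (condLaw μ F F') (actMiniflag k F) ∂(μ.map (actPair F))

/-- The uniform fibrewise push-forward entropy of `μ` acting on the bundle
`PF(k-1, k, k+1) → PF(k-1, k+1)`: the infimum of `h_FA(F, μ)` over all miniflags. -/
def uniformFiberwiseEntropy {d : ℕ} (k : ℕ) (μ : Measure (Mat d)) [IsFiniteMeasure μ] : ℝ≥0∞ :=
  ⨅ F ∈ PF d k, fiberAveragedEntropy k μ F

end

noncomputable section

/-! ### Measurability of the action on subspaces -/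

/-! Fix `F` and an orthonormal frame `u, v` of the plane orthogonal to `V_{k-1}` in `V_{k+1}`. The
miniflag over `F` is the projective line of this plane. The transvections `g = 1 + t u vᵀ` and `1 +
t v uᵀ` fix `F` and act on that line as the two elementary unipotents. Since `B g F = B F`, right
multiplication by `g` moves mass only inside the fibres of `B ↦ B F`, hence inside the conditional
laws.

Near a matrix `E₀` with `φ E₀ > 0` the density is almost constant. In the noise variable `B ↦ B g`
is a volume-preserving affine map with displacement of order `t M / ε`. So for `t` of order `ε / M`
the law of `B`, restricted to a good set `R` and pushed by `g`, is at most `4 μ`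
(`map_restrict_mul_unipotent_le`). This domination passes to almost every conditional law `κ`
(`condDistrib_restrict_map_le`).

If `B_* ν` and `(B g)_* ν` are both close in relative entropy to the same mean measure, then `ν` is
close to `g_* ν`, by a weak Pinsker inequality (`sq_sub_le_klDiv`). Averaging over `R` makes `ν`
`δ`-invariant under `g`, with `δ²` comparable to `Φ(ν) / κ(R)`. Iterating `n = 1/t` times gives
`nδ`-invariance under both unit transvections. A ping-pong argument (`one_le_of_almost_invariant`)
shows that no probability measure on the line is better than `1/10`-invariant under both. Hence
`Φ(ν)` is at least a constant times `κ(R) / n²`. This is linear in `κ(R)`, so integration over `F'`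
replaces `κ(R)` by `μ(R)`, which does not depend on `A` or `ε`. -/

instance (d : ℕ) : SecondCountableTopology (Subsp d) :=
  Topology.IsInducing.secondCountableTopology
    (f := fun V : Subsp d =>
      (V.starProjection : EuclideanSpace ℝ (Fin d) →L[ℝ] EuclideanSpace ℝ (Fin d))) ⟨rfl⟩

theorem continuous_toEuclideanCLM (d : ℕ) :
    Continuous fun A : Mat d => Matrix.toEuclideanCLM (n := Fin d) (𝕜 := ℝ) A :=
  LinearMap.continuous_of_finiteDimensional
    (Matrix.toEuclideanCLM (n := Fin d) (𝕜 := ℝ)).toAlgEquiv.toLinearMap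

theorem continuous_toEuclideanCLM_symm (d : ℕ) :
    Continuous fun A : EuclideanSpace ℝ (Fin d) →L[ℝ] EuclideanSpace ℝ (Fin d) =>
      (Matrix.toEuclideanCLM (n := Fin d) (𝕜 := ℝ)).symm A :=
  LinearMap.continuous_of_finiteDimensional
    (Matrix.toEuclideanCLM (n := Fin d) (𝕜 := ℝ)).symm.toAlgEquiv.toLinearMap

theorem measurable_starProjection_apply {d : ℕ} (x : EuclideanSpace ℝ (Fin d)) :
    Measurable fun V : Subsp d => V.starProjection x := by
  have h : Continuous fun V : Subsp d =>
      (V.starProjection : EuclideanSpace ℝ (Fin d) →L[ℝ] EuclideanSpace ℝ (Fin d)) :=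
    continuous_induced_dom
  exact (h.clm_apply continuous_const).measurable

theorem measurable_mat_iff {α : Type*} [MeasurableSpace α] {d : ℕ} {f : α → Mat d} :
    Measurable f ↔ ∀ i j, Measurable fun a => f a i j := by
  constructor
  · intro h i j
    exact measurable_pi_iff.1 (measurable_pi_iff.1 (h : Measurable (fun a => f a : α → Fin d → Fin d → ℝ)) i) j
  · intro h
    have : Measurable (fun a => f a : α → Fin d → Fin d → ℝ) :=
      measurable_pi_iff.2 fun i => measurable_pi_iff.2 fun j => h i j
    exact this

theorem measurable_subsp {α : Type*} [MeasurableSpace α] {d : ℕ} {f : α → Subsp d}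
    (hf : ∀ x y, Measurable fun a => inner ℝ x ((f a).starProjection y)) : Measurable f := by
  have h1 : Measurable fun a =>
      ((Matrix.toEuclideanCLM (n := Fin d) (𝕜 := ℝ)).symm (f a).starProjection : Mat d) := by
    rw [measurable_mat_iff]
    intro i j
    convert hf (EuclideanSpace.single i 1) (EuclideanSpace.single j 1) using 2 with a
    obtain ⟨A, hA⟩ : ∃ A : Mat d, Matrix.toEuclideanCLM (n := Fin d) (𝕜 := ℝ) A =
        (f a).starProjection := EquivLike.surjective _ _
    rw [← hA, Matrix.inner_toEuclideanCLM]
    simp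
  borelize (EuclideanSpace ℝ (Fin d) →L[ℝ] EuclideanSpace ℝ (Fin d))
  have h2 := (continuous_toEuclideanCLM d).measurable.comp h1
  have h5 : @Measurable _ _ _ (MeasurableSpace.comap
      (fun V : Subsp d =>
        (V.starProjection : EuclideanSpace ℝ (Fin d) →L[ℝ] EuclideanSpace ℝ (Fin d)))
      (borel _)) f := by
    rw [measurable_comap_iff]
    convert h2 using 1
    ext1 a
    simp
  rw [← borel_comap] at h5
  exact h5

/-- Pythagoras. Writing the quadratic form through a distance makes it computable from any dense
subset of `V`. -/
theorem inner_starProjection_self_eq {E : Type*} [NormedAddCommGroup E] [InnerProductSpace ℝ E]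
    (V : Submodule ℝ E) [V.HasOrthogonalProjection] (x : E) :
    inner ℝ x (V.starProjection x) = ‖x‖ ^ 2 - (Metric.infEDist x V).toReal ^ 2 := by
  have h0 : ∀ w ∈ V, inner ℝ (x - V.starProjection x) w = 0 := fun w hw =>
    V.starProjection_inner_eq_zero x w hw
  have h1 : Metric.infEDist x V = edist x (V.starProjection x) := by
    apply le_antisymm (Metric.infEDist_le_edist_of_mem (V.starProjection_apply_mem x))
    rw [Metric.le_infEDist]
    intro y hy
    rw [edist_dist, edist_dist, dist_eq_norm, dist_eq_norm]
    apply ENNReal.ofReal_le_ofReal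
    have h2 := h0 (V.starProjection x - y) (V.sub_mem (V.starProjection_apply_mem x) hy)
    have h3 := norm_add_sq_real (x - V.starProjection x) (V.starProjection x - y)
    rw [sub_add_sub_cancel, h2] at h3
    apply le_of_sq_le_sq _ (norm_nonneg _)
    nlinarith [sq_nonneg ‖V.starProjection x - y‖]
  have h4 := h0 _ (V.starProjection_apply_mem x)
  have h5 := norm_add_sq_real (x - V.starProjection x) (V.starProjection x)
  rw [sub_add_cancel, h4] at h5
  rw [inner_sub_left, real_inner_self_eq_norm_sq] at h4
  rw [h1, edist_dist, dist_eq_norm, ENNReal.toReal_ofReal (norm_nonneg _)]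
  linarith

/-- The action is discontinuous where the dimension of the image drops, so measurability needs an
argument. The quadratic form of the projection onto `B V` is given by distances to `B V`, each a
countable infimum of functions continuous in `B` and in the projection onto `V`. Polarization
recovers all matrix coefficients. -/
theorem measurable_actSubsp_uncurry (d : ℕ) :
    Measurable fun p : Mat d × Subsp d => actSubsp p.1 p.2 := by
  have hT : Measurable fun p : Mat d × EuclideanSpace ℝ (Fin d) =>
      Matrix.toEuclideanCLM (n := Fin d) (𝕜 := ℝ) p.1 p.2 :=
    (((continuous_toEuclideanCLM d).comp continuous_fst).clm_apply continuous_snd).measurable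
  -- The image is the range of the continuous map `B ∘ P_V`, so the values on a dense sequence
  -- suffice for the distance.
  have hd : ∀ (p : Mat d × Subsp d) (x : EuclideanSpace ℝ (Fin d)),
      Metric.infEDist x (actSubsp p.1 p.2) = ⨅ n : ℕ, edist x (Matrix.toEuclideanCLM
        (n := Fin d) (𝕜 := ℝ) p.1
          (p.2.starProjection (TopologicalSpace.denseSeq (EuclideanSpace ℝ (Fin d)) n))) := by
    intro p x
    set q := TopologicalSpace.denseSeq (EuclideanSpace ℝ (Fin d))
    set g : EuclideanSpace ℝ (Fin d) → EuclideanSpace ℝ (Fin d) := fun y =>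
      Matrix.toEuclideanCLM (n := Fin d) (𝕜 := ℝ) p.1 (p.2.starProjection y)
    have hg : Continuous g := by fun_prop
    have h1 : (actSubsp p.1 p.2 : Set (EuclideanSpace ℝ (Fin d))) = Set.range g := by
      ext y
      simp only [actSubsp, SetLike.mem_coe, Submodule.mem_map, Set.mem_range]
      constructor
      · rintro ⟨z, hz, rfl⟩
        exact ⟨z, by
          simp only [g]; rw [Submodule.starProjection_eq_self_iff.2 hz]; rfl⟩
      · rintro ⟨z, rfl⟩
        exact ⟨_, p.2.starProjection_apply_mem z, rfl⟩
    have h2 : Metric.infEDist x (Set.range g) = Metric.infEDist x (Set.range (g ∘ q)) := by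
      apply le_antisymm
      · exact Metric.infEDist_anti (Set.range_comp_subset_range q g)
      · rw [← Metric.infEDist_closure (s := Set.range (g ∘ q)), Set.range_comp]
        apply Metric.infEDist_anti
        exact hg.range_subset_closure_image_dense (TopologicalSpace.denseRange_denseSeq _)
    rw [h1, h2, Metric.infEDist, iInf_range]
    rfl
  have hs : ∀ x : EuclideanSpace ℝ (Fin d),
      Measurable fun p : Mat d × Subsp d => inner ℝ x ((actSubsp p.1 p.2).starProjection x) := by
    intro x
    simp_rw [inner_starProjection_self_eq, hd]
    have hn : ∀ q : EuclideanSpace ℝ (Fin d), Measurable fun p : Mat d × Subsp d =>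
        edist x (Matrix.toEuclideanCLM (n := Fin d) (𝕜 := ℝ) p.1 (p.2.starProjection q)) := by
      intro q
      have h1 : Measurable fun p : Mat d × Subsp d => (p.1, p.2.starProjection q) :=
        measurable_fst.prodMk ((measurable_starProjection_apply q).comp measurable_snd)
      have h2 := hT.comp h1
      have h3 := (measurable_const (a := x)).edist h2
      exact h3
    have := Measurable.iInf fun n =>
      hn (TopologicalSpace.denseSeq (EuclideanSpace ℝ (Fin d)) n)
    exact measurable_const.sub (this.ennreal_toReal.pow_const 2)
  refine measurable_subsp fun x y => ?_
  have hp : ∀ V : Subsp d, inner ℝ x (V.starProjection y) =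
      (inner ℝ (x + y) (V.starProjection (x + y)) - inner ℝ x (V.starProjection x) -
        inner ℝ y (V.starProjection y)) / 2 := by
    intro V
    have := V.inner_starProjection_left_eq_right y x
    rw [real_inner_comm] at this
    rw [map_add, inner_add_left, inner_add_right, inner_add_right]
    linarith
  simp_rw [hp]
  exact (((hs _).sub (hs _)).sub (hs _)).div_const _

theorem measurable_actSubsp {d : ℕ} (B : Mat d) : Measurable (actSubsp B) := by
  have h : Measurable fun V : Subsp d => (B, V) := measurable_prodMk_left
  have h2 := (measurable_actSubsp_uncurry d).comp h
  exact h2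

theorem measurable_actPair {d : ℕ} (F : Subsp d × Subsp d) : Measurable (actPair F) := by
  have h : ∀ V : Subsp d, Measurable fun B : Mat d => actSubsp B V := fun V => by
    have h : Measurable fun B : Mat d => (B, V) := measurable_prodMk_right
    have h2 := (measurable_actSubsp_uncurry d).comp h
    exact h2
  exact (h F.1).prodMk (h F.2)

theorem actSubsp_mul {d : ℕ} (A B : Mat d) (V : Subsp d) :
    actSubsp (A * B) V = actSubsp A (actSubsp B V) := by
  unfold actSubsp
  rw [← Submodule.map_comp]
  congr 1
  simp

theorem actSubsp_one {d : ℕ} (V : Subsp d) : actSubsp (1 : Mat d) V = V := by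
  simp [actSubsp]

/-! ### Lower bounds for the Kullback-Leibler divergence -/

/-- Young's inequality: `s ↦ exp s - 1` is the convex conjugate of `klFun`. -/
theorem InformationTheory.mul_sub_exp_le_klFun {r : ℝ} (hr : 0 ≤ r) (s : ℝ) :
    s * r - (Real.exp s - 1) ≤ klFun r := by
  rcases hr.eq_or_lt with rfl | hr
  · simp [klFun]; positivity
  · have h := Real.add_one_le_exp (s - Real.log r)
    rw [Real.exp_sub, Real.exp_log hr, le_div_iff₀ hr] at h
    unfold klFun
    linarith

/-- A Pinsker-type bound, from integrating Young's inequality with a constant slope over `S` and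
using `klFun ≥ 0` off `S`. Only `m univ ≤ 1` is assumed, so that no measurability of the family of
push-forwards is needed later. -/
theorem sq_sub_le_klDiv {X : Type*} [MeasurableSpace X] (p m : Measure X) [IsProbabilityMeasure p]
    (hm : m Set.univ ≤ 1) {S : Set X} (hS : MeasurableSet S) :
    ENNReal.ofReal ((p.real S - m.real S) ^ 2 / 4) ≤ InformationTheory.klDiv p m := by
  have : IsFiniteMeasure m := ⟨hm.trans_lt ENNReal.one_lt_top⟩
  by_cases htop : InformationTheory.klDiv p m = ∞
  · rw [htop]; exact le_top
  obtain ⟨hac, hint⟩ := InformationTheory.klDiv_ne_top_iff.1 htop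
  rw [ENNReal.ofReal_le_iff_le_toReal htop, InformationTheory.toReal_klDiv_eq_integral_klFun hac]
  have hmS : m.real S ≤ 1 := by
    have : m S ≤ 1 := (measure_mono (Set.subset_univ _)).trans hm
    exact ENNReal.toReal_le_of_le_ofReal zero_le_one (by simpa using this)
  have hpS : p.real S ≤ 1 := measureReal_le_one
  have hm0 : 0 ≤ m.real S := measureReal_nonneg
  have hp0 : 0 ≤ p.real S := measureReal_nonneg
  -- With `exp t - 1 ≤ t + t²` and `m S ≤ 1`, the bound becomes `t (p S - m S) - t²`, which this `t`
  -- maximizes.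
  set t : ℝ := (p.real S - m.real S) / 2 with ht
  have hkl : Integrable (fun x => InformationTheory.klFun (p.rnDeriv m x).toReal) m :=
    (InformationTheory.integrable_klFun_rnDeriv_iff hac).2 hint
  have hrn : Integrable (fun x => (p.rnDeriv m x).toReal) m := Measure.integrable_toReal_rnDeriv
  have h1 : ∫ x, S.indicator (fun x => t * (p.rnDeriv m x).toReal - (Real.exp t - 1)) x ∂m ≤
      ∫ x, InformationTheory.klFun (p.rnDeriv m x).toReal ∂m := by
    refine integral_mono (((hrn.const_mul t).sub (integrable_const _)).indicator hS) hkl fun x => ?_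
    by_cases hx : x ∈ S
    · simp only [Set.indicator_of_mem hx]
      exact InformationTheory.mul_sub_exp_le_klFun ENNReal.toReal_nonneg t
    · simp only [Set.indicator_of_notMem hx]
      exact InformationTheory.klFun_nonneg ENNReal.toReal_nonneg
  rw [integral_indicator hS, integral_sub (hrn.const_mul t).integrableOn
    (integrable_const _), integral_const_mul, Measure.setIntegral_toReal_rnDeriv hac,
    setIntegral_const, smul_eq_mul] at h1
  have ht1 : |t| ≤ 1 := by rw [abs_le]; constructor <;> linarith
  have h2 : Real.exp t - 1 ≤ t + t ^ 2 := by
    have := Real.abs_exp_sub_one_sub_id_le ht1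
    have := le_abs_self (Real.exp t - 1 - t)
    linarith
  have h3 : m.real S * (Real.exp t - 1) ≤ m.real S * t + t ^ 2 := by
    have := mul_le_mul_of_nonneg_left h2 hm0
    nlinarith [sq_nonneg t]
  refine le_trans ?_ h1
  have h4 : (p.real S - m.real S) ^ 2 / 4 = t * (p.real S - m.real S) - t ^ 2 := by
    rw [ht]; ring
  rw [h4]
  linarith

theorem sq_sub_le_klDiv_add_klDiv {X : Type*} [MeasurableSpace X] (p q m : Measure X)
    [IsProbabilityMeasure p] [IsProbabilityMeasure q]
    (hm : m Set.univ ≤ 1) {S : Set X} (hS : MeasurableSet S) :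
    ENNReal.ofReal ((p.real S - q.real S) ^ 2 / 8) ≤
      InformationTheory.klDiv p m + InformationTheory.klDiv q m := by
  refine le_trans ?_ (add_le_add (sq_sub_le_klDiv p m hm hS) (sq_sub_le_klDiv q m hm hS))
  rw [← ENNReal.ofReal_add (by positivity) (by positivity)]
  apply ENNReal.ofReal_le_ofReal
  nlinarith [sq_nonneg (p.real S - m.real S + (q.real S - m.real S))]

/-- Countable generation provides a jointly measurable version of the Radon-Nikodym derivatives, and
a measurable set of parameters at which absolute continuity holds. -/
theorem measurable_klDiv_kernel {Ω X : Type*} [MeasurableSpace Ω] [MeasurableSpace X]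
    [MeasurableSpace.CountablyGenerated X] (κ η : Kernel Ω X) [IsFiniteKernel κ]
    [IsFiniteKernel η] : Measurable fun ω => InformationTheory.klDiv (κ ω) (η ω) := by
  classical
  have h : ∀ ω, InformationTheory.klDiv (κ ω) (η ω) = if κ ω ≪ η ω then
      ∫⁻ x, ENNReal.ofReal (InformationTheory.klFun (κ.rnDeriv η ω x).toReal) ∂(η ω) else ∞ := by
    intro ω
    split_ifs with hac
    · rw [InformationTheory.klDiv_eq_lintegral_klFun_of_ac hac]
      refine lintegral_congr_ae ?_
      filter_upwards [Kernel.rnDeriv_eq_rnDeriv_measure (κ := κ) (η := η) (a := ω)] with x hx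
      rw [hx]
    · exact InformationTheory.klDiv_of_not_ac hac
  simp_rw [h]
  refine Measurable.ite (Kernel.measurableSet_absolutelyContinuous κ η) ?_ measurable_const
  refine Measurable.lintegral_kernel_prod_right (f := fun ω x =>
    ENNReal.ofReal (InformationTheory.klFun (κ.rnDeriv η ω x).toReal)) ?_
  exact (InformationTheory.measurable_klFun.comp
    (Kernel.measurable_rnDeriv κ η).ennreal_toReal).ennreal_ofReal

theorem measurable_klDiv_map {Ω X Y : Type*} [MeasurableSpace Ω] [MeasurableSpace X]
    [MeasurableSpace Y] [MeasurableSpace.CountablyGenerated Y] {f : Ω → X → Y}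
    (hf : Measurable (Function.uncurry f)) (ν : Measure X) [IsFiniteMeasure ν]
    (m : Measure Y) [IsFiniteMeasure m] :
    Measurable fun ω => InformationTheory.klDiv (ν.map (f ω)) m := by
  have h : ∀ ω, ν.map (f ω) = ((Kernel.id ×ₖ Kernel.const Ω ν).map (Function.uncurry f)) ω := by
    intro ω
    rw [Kernel.map_apply _ hf, Kernel.prod_apply, Kernel.id_apply, Kernel.const_apply,
      Measure.dirac_prod, Measure.map_map hf measurable_prodMk_left]
    rfl
  simp_rw [h]
  exact measurable_klDiv_kernel _ (Kernel.const Ω m)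

/-- Where measurability fails, `map` and `bind` take the value `0`, so the bound holds for arbitrary
families. -/
theorem meanPushforward_univ_le {Ω X Y : Type*} [MeasurableSpace Ω] [MeasurableSpace X]
    [MeasurableSpace Y] (μ : Measure Ω) [IsProbabilityMeasure μ] (f : Ω → X → Y) (ν : Measure X)
    [IsProbabilityMeasure ν] : meanPushforward μ f ν Set.univ ≤ 1 := by
  unfold meanPushforward
  by_cases h : AEMeasurable (fun ω => ν.map (f ω)) μ
  · rw [Measure.bind_apply MeasurableSet.univ h]
    calc ∫⁻ ω, ν.map (f ω) Set.univ ∂μ ≤ ∫⁻ _, 1 ∂μ := by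
          refine lintegral_mono fun ω => ?_
          by_cases hf : AEMeasurable (f ω) ν
          · rw [Measure.map_apply_of_aemeasurable hf MeasurableSet.univ]
            exact prob_le_one
          · simp [Measure.map_of_not_aemeasurable hf]
      _ = 1 := by simp
  · simp [Measure.bind, Measure.map_of_not_aemeasurable h]

/-! ### Frames of miniflags and unipotent matrices -/

/-- The matrix of the transvection `x ↦ x + t ⟪v, x⟫ u`. -/
def unipotent {d : ℕ} (u v : EuclideanSpace ℝ (Fin d)) (t : ℝ) : Mat d :=
  1 + t • Matrix.vecMulVec u.ofLp v.ofLp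

theorem toEuclideanLin_unipotent {d : ℕ} (u v : EuclideanSpace ℝ (Fin d)) (t : ℝ)
    (x : EuclideanSpace ℝ (Fin d)) :
    Matrix.toEuclideanLin (unipotent u v t) x = x + (t * inner ℝ v x) • u := by
  have h : inner ℝ v x = v.ofLp ⬝ᵥ x.ofLp := by
    rw [EuclideanSpace.inner_eq_star_dotProduct, star_trivial, dotProduct_comm]
  ext i
  rw [h]
  simp [unipotent, Matrix.vecMulVec_mulVec]
  ring

theorem unipotent_mul {d : ℕ} {u v : EuclideanSpace ℝ (Fin d)} (huv : inner ℝ u v = 0)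
    (s t : ℝ) : unipotent u v s * unipotent u v t = unipotent u v (s + t) := by
  apply Matrix.toEuclideanLin.injective
  ext1 x
  have h : Matrix.toEuclideanLin (unipotent u v s * unipotent u v t) x =
      Matrix.toEuclideanLin (unipotent u v s) (Matrix.toEuclideanLin (unipotent u v t) x) := by
    simp
  rw [h]
  simp only [toEuclideanLin_unipotent, inner_add_right, inner_smul_right]
  rw [show inner ℝ v u = 0 by rw [real_inner_comm]; exact huv, add_assoc, ← add_smul]
  congr 2
  ring

theorem unipotent_zero {d : ℕ} (u v : EuclideanSpace ℝ (Fin d)) : unipotent u v 0 = 1 := by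
  simp [unipotent]

theorem det_unipotent {d : ℕ} {u v : EuclideanSpace ℝ (Fin d)} (huv : inner ℝ u v = 0) (t : ℝ) :
    (unipotent u v t).det = 1 := by
  have h : inner ℝ u v = v.ofLp ⬝ᵥ u.ofLp := by
    rw [EuclideanSpace.inner_eq_star_dotProduct, star_trivial]
  rw [unipotent, ← Matrix.smul_vecMulVec, Matrix.vecMulVec_eq Unit,
    Matrix.det_one_add_replicateCol_mul_replicateRow]
  simp [dotProduct_smul, ← h, huv]

theorem actSubsp_unipotent_of_orthogonal {d : ℕ} {u v : EuclideanSpace ℝ (Fin d)} (t : ℝ)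
    {V : Subsp d} (hv : v ∈ Vᗮ) : actSubsp (unipotent u v t) V = V := by
  have h : ∀ x ∈ V, Matrix.toEuclideanLin (unipotent u v t) x = x := fun x hx => by
    rw [toEuclideanLin_unipotent, Submodule.inner_left_of_mem_orthogonal hx hv]; simp
  ext x
  simp only [actSubsp, Submodule.mem_map]
  constructor
  · rintro ⟨y, hy, rfl⟩
    rwa [h y hy]
  · exact fun hx => ⟨x, hx, h x hx⟩

theorem actSubsp_unipotent_of_mem {d : ℕ} {u v : EuclideanSpace ℝ (Fin d)} (t : ℝ)
    (huv : inner ℝ u v = 0) {V : Subsp d} (hu : u ∈ V) : actSubsp (unipotent u v t) V = V := by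
  have h : ∀ t, actSubsp (unipotent u v t) V ≤ V := by
    rintro t _ ⟨y, hy, rfl⟩
    rw [toEuclideanLin_unipotent]
    exact V.add_mem hy (V.smul_mem _ hu)
  refine le_antisymm (h t) ?_
  have h1 : actSubsp (unipotent u v t) (actSubsp (unipotent u v (-t)) V) = V := by
    rw [← actSubsp_mul, unipotent_mul huv, add_neg_cancel, unipotent_zero, actSubsp_one]
  calc V = actSubsp (unipotent u v t) (actSubsp (unipotent u v (-t)) V) := h1.symm
    _ ≤ actSubsp (unipotent u v t) V := Submodule.map_mono (h (-t))

theorem actSubsp_unipotent_sup_span {d : ℕ} {u v : EuclideanSpace ℝ (Fin d)} (t : ℝ)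
    {V : Subsp d} (hv : v ∈ Vᗮ) (w : EuclideanSpace ℝ (Fin d)) :
    actSubsp (unipotent u v t) (V ⊔ ℝ ∙ w) = V ⊔ ℝ ∙ (w + (t * inner ℝ v w) • u) := by
  have h := actSubsp_unipotent_of_orthogonal (u := u) t hv
  unfold actSubsp at h ⊢
  rw [Submodule.map_sup, h, Submodule.map_span, Set.image_singleton, toEuclideanLin_unipotent]

/-- An orthonormal frame `u, v` of the plane orthogonal to `V_{k-1}` in `V_{k+1}`. -/
structure IsMiniflagFrame {d : ℕ} (F : Subsp d × Subsp d) (u v : EuclideanSpace ℝ (Fin d)) :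
    Prop where
  norm_left : ‖u‖ = 1
  norm_right : ‖v‖ = 1
  inner_eq_zero : inner ℝ u v = 0
  left_mem : u ∈ F.1ᗮ
  right_mem : v ∈ F.1ᗮ
  orthogonal_inf_eq : F.1ᗮ ⊓ F.2 = Submodule.span ℝ {u, v}

theorem IsMiniflagFrame.symm {d : ℕ} {F : Subsp d × Subsp d} {u v : EuclideanSpace ℝ (Fin d)}
    (h : IsMiniflagFrame F u v) : IsMiniflagFrame F v u :=
  ⟨h.2, h.1, by rw [real_inner_comm]; exact h.3, h.5, h.4, by rw [h.6, Set.pair_comm]⟩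

theorem exists_isMiniflagFrame {d k : ℕ} {F : Subsp d × Subsp d} (hF : F ∈ PF d k) :
    ∃ u v, IsMiniflagFrame F u v := by
  obtain ⟨hle, h1, h2⟩ := hF
  have hr := Submodule.finrank_add_inf_finrank_orthogonal hle
  have hr2 : Module.finrank ℝ (F.1ᗮ ⊓ F.2 : Subsp d) = 2 := by omega
  let b := (stdOrthonormalBasis ℝ (F.1ᗮ ⊓ F.2 : Subsp d)).reindex (finCongr hr2)
  have hb := b.orthonormal
  refine ⟨b 0, b 1, hb.1 0, hb.1 1, hb.2 (by decide), (b 0).2.1, (b 1).2.1, ?_⟩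
  have hs := b.toBasis.span_eq
  have hm := congrArg (Submodule.map (F.1ᗮ ⊓ F.2 : Subsp d).subtype) hs
  rw [Submodule.map_span, Submodule.map_top, Submodule.range_subtype] at hm
  refine hm.symm.trans ?_
  congr 1
  ext x
  simp only [Set.mem_image, Set.mem_range, Set.mem_insert_iff, Set.mem_singleton_iff,
    OrthonormalBasis.coe_toBasis, Submodule.coe_subtype]
  constructor
  · rintro ⟨_, ⟨i, rfl⟩, rfl⟩
    fin_cases i <;> simp
  · rintro (rfl | rfl)
    · exact ⟨_, ⟨0, rfl⟩, rfl⟩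
    · exact ⟨_, ⟨1, rfl⟩, rfl⟩

/-- Homogeneous coordinates `(a : b)` on the miniflag: `V` is determined by the line orthogonal to
`V_{k-1}` inside it, and that line lies in the plane of the frame. -/
theorem exists_eq_sup_span_of_mem_miniflag {d k : ℕ} {F : Subsp d × Subsp d} (hF : F ∈ PF d k)
    {u v : EuclideanSpace ℝ (Fin d)} (h : IsMiniflagFrame F u v) {V : Subsp d}
    (hV : V ∈ miniflag k F) :
    ∃ a b : ℝ, 0 < a ^ 2 + b ^ 2 ∧ V = F.1 ⊔ ℝ ∙ (a • u + b • v) := by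
  obtain ⟨hle, h1, h2⟩ := hF
  obtain ⟨hV1, hV2, hVk⟩ := hV
  have hr := Submodule.finrank_add_inf_finrank_orthogonal hV1
  have hr1 : Module.finrank ℝ (F.1ᗮ ⊓ V : Subsp d) = 1 := by omega
  obtain ⟨w, hw0, hw⟩ := finrank_eq_one_iff'.1 hr1
  have hwm : (w : EuclideanSpace ℝ (Fin d)) ∈ F.1ᗮ ⊓ F.2 := ⟨w.2.1, hV2 w.2.2⟩
  rw [h.orthogonal_inf_eq, Submodule.mem_span_pair] at hwm
  obtain ⟨a, b, hab⟩ := hwm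
  refine ⟨a, b, ?_, ?_⟩
  · by_contra hn
    have ha : a = 0 := by nlinarith [sq_nonneg a, sq_nonneg b]
    have hb : b = 0 := by nlinarith [sq_nonneg a, sq_nonneg b]
    apply hw0
    ext1
    rw [← hab, ha, hb]
    simp
  · rw [hab]
    conv_lhs => rw [← Submodule.sup_orthogonal_inf_of_hasOrthogonalProjection hV1]
    congr 1
    apply le_antisymm
    · intro x hx
      obtain ⟨c, hc⟩ := hw ⟨x, hx⟩
      rw [Submodule.mem_span_singleton]
      exact ⟨c, congrArg Subtype.val hc⟩
    · rw [Submodule.span_singleton_le_iff_mem]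
      exact w.2

theorem IsMiniflagFrame.starProjection_apply {d : ℕ} {F : Subsp d × Subsp d}
    {u v : EuclideanSpace ℝ (Fin d)} (h : IsMiniflagFrame F u v) {a b : ℝ}
    (hab : 0 < a ^ 2 + b ^ 2) {x : EuclideanSpace ℝ (Fin d)} (hx : x ∈ F.1ᗮ) :
    (F.1 ⊔ ℝ ∙ (a • u + b • v)).starProjection x =
      ((a * inner ℝ u x + b * inner ℝ v x) / (a ^ 2 + b ^ 2)) • (a • u + b • v) := by
  apply Submodule.eq_starProjection_of_mem_orthogonal
  · exact Submodule.smul_mem _ _ (Submodule.mem_sup_right (Submodule.mem_span_singleton_self _))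
  · rw [← Submodule.inf_orthogonal]
    refine ⟨Submodule.sub_mem _ hx (Submodule.smul_mem _ _ (Submodule.add_mem _
      (Submodule.smul_mem _ _ h.left_mem) (Submodule.smul_mem _ _ h.right_mem))), ?_⟩
    refine Submodule.mem_orthogonal_singleton_iff_inner_right.2 ?_
    have h1 : inner ℝ v u = 0 := by rw [real_inner_comm]; exact h.inner_eq_zero
    simp only [inner_sub_right, inner_add_left, inner_add_right, inner_smul_left,
      inner_smul_right, h.inner_eq_zero, h1, real_inner_self_eq_norm_sq, h.norm_left, h.norm_right,
      conj_trivial]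
    field_simp
    ring

theorem IsMiniflagFrame.actSubsp_unipotent {d : ℕ} {F : Subsp d × Subsp d}
    {u v : EuclideanSpace ℝ (Fin d)} (h : IsMiniflagFrame F u v) (t a b : ℝ) :
    actSubsp (unipotent u v t) (F.1 ⊔ ℝ ∙ (a • u + b • v)) =
      F.1 ⊔ ℝ ∙ ((a + t * b) • u + b • v) := by
  have h1 : inner ℝ v u = 0 := by rw [real_inner_comm]; exact h.inner_eq_zero
  rw [actSubsp_unipotent_sup_span t h.right_mem]
  congr 3
  simp only [inner_add_right, inner_smul_right, h1, real_inner_self_eq_norm_sq, h.norm_right]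
  module

/-- The transvection is the identity on `V_{k-1}`, which is orthogonal to `v`, and preserves
`V_{k+1}`, which contains `u`. -/
theorem IsMiniflagFrame.actPair_mul_unipotent {d : ℕ} {F : Subsp d × Subsp d} 
    {u v : EuclideanSpace ℝ (Fin d)} (h : IsMiniflagFrame F u v) (t : ℝ) (B : Mat d) :
    actPair F (B * unipotent u v t) = actPair F B := by
  have hu : u ∈ F.2 := by
    have : u ∈ Submodule.span ℝ {u, v} := Submodule.subset_span (by simp)
    rw [← h.orthogonal_inf_eq] at this
    exact this.2
  simp only [actPair, actSubsp_mul, actSubsp_unipotent_of_orthogonal t h.right_mem,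
    actSubsp_unipotent_of_mem t h.inner_eq_zero hu]

/-- The coordinates `⟪x, P_V y⟫` of a subspace. -/
def projCoord {d : ℕ} (x y : EuclideanSpace ℝ (Fin d)) (V : Subsp d) : ℝ :=
  inner ℝ x (V.starProjection y)

theorem measurable_projCoord {d : ℕ} (x y : EuclideanSpace ℝ (Fin d)) :
    Measurable (projCoord x y) :=
  measurable_const.inner (measurable_starProjection_apply y)

/-! ### Projective coordinates and almost invariant measures on a miniflag. -/

theorem IsMiniflagFrame.projCoord_eq {d : ℕ} {F : Subsp d × Subsp d}
    {u v : EuclideanSpace ℝ (Fin d)} (h : IsMiniflagFrame F u v) {a b : ℝ}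
    (hab : 0 < a ^ 2 + b ^ 2) :
    projCoord u u (F.1 ⊔ ℝ ∙ (a • u + b • v)) = a ^ 2 / (a ^ 2 + b ^ 2) ∧
    projCoord u v (F.1 ⊔ ℝ ∙ (a • u + b • v)) = a * b / (a ^ 2 + b ^ 2) ∧
    projCoord v v (F.1 ⊔ ℝ ∙ (a • u + b • v)) = b ^ 2 / (a ^ 2 + b ^ 2) := by
  have h1 : inner ℝ v u = 0 := by rw [real_inner_comm]; exact h.inner_eq_zero
  refine ⟨?_, ?_, ?_⟩ <;>
  · unfold projCoord
    first
      | rw [h.starProjection_apply hab h.left_mem]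
      | rw [h.starProjection_apply hab h.right_mem]
    simp only [inner_add_right, inner_smul_right, h.inner_eq_zero, h1,
      real_inner_self_eq_norm_sq, h.norm_left, h.norm_right]
    ring

/-- Ping-pong on the projective line for `(a : b) ↦ (a + b : b)` and `(a : b) ↦ (a : a + b)`. The
line splits into `ab > 0`, `ab < 0` and the two axis points, of measure at most `2δ`, `2δ`, `3δ` and
`3δ`; the total is `1`. -/
theorem one_le_of_almost_invariant {d k : ℕ} {F : Subsp d × Subsp d} (hF : F ∈ PF d k)
    {u v : EuclideanSpace ℝ (Fin d)} (h : IsMiniflagFrame F u v)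
    (ν : Measure (miniflag k F)) [IsProbabilityMeasure ν] {δ : ℝ}
    (hu : ∀ T : Set (Subsp d), MeasurableSet T → |ν.real {V | (V : Subsp d) ∈ T} -
      ν.real {V | actSubsp (unipotent u v 1) V ∈ T}| ≤ δ)
    (hv : ∀ T : Set (Subsp d), MeasurableSet T → |ν.real {V | (V : Subsp d) ∈ T} -
      ν.real {V | actSubsp (unipotent v u 1) V ∈ T}| ≤ δ) :
    1 ≤ 10 * δ := by
  -- The factors `c` and `e` are inverse squared norms. Only signs and comparisons of coordinates
  -- are used below, so their positivity is enough.
  have key : ∀ V : miniflag k F, ∃ a b c : ℝ, 0 < c ∧ 0 < a ^ 2 + b ^ 2 ∧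
      projCoord u u V = a ^ 2 * c ∧ projCoord u v V = a * b * c ∧ projCoord v v V = b ^ 2 * c ∧
      (∃ e : ℝ, 0 < e ∧ projCoord u v (actSubsp (unipotent u v 1) V) = (a + b) * b * e ∧
        projCoord v v (actSubsp (unipotent u v 1) V) = b ^ 2 * e) ∧
      (∃ e : ℝ, 0 < e ∧ projCoord u v (actSubsp (unipotent v u 1) V) = a * (a + b) * e ∧
        projCoord v v (actSubsp (unipotent v u 1) V) = (a + b) ^ 2 * e) := by
    rintro ⟨V, hV⟩
    obtain ⟨a, b, hab, rfl⟩ := exists_eq_sup_span_of_mem_miniflag hF h hV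
    have h1 : 0 < (a + b) ^ 2 + b ^ 2 := by
      by_contra hn
      nlinarith [sq_nonneg (a + b), sq_nonneg b, sq_nonneg (a + b + b)]
    have h2 : 0 < a ^ 2 + (a + b) ^ 2 := by
      by_contra hn
      nlinarith [sq_nonneg (a + b), sq_nonneg a, sq_nonneg (a + b + a)]
    obtain ⟨e1, e2, e3⟩ := h.projCoord_eq hab
    have hL : actSubsp (unipotent v u 1) (F.1 ⊔ ℝ ∙ (a • u + b • v)) =
        F.1 ⊔ ℝ ∙ (a • u + (a + b) • v) := by
      rw [add_comm (a • u), h.symm.actSubsp_unipotent, one_mul, add_comm ((b + a) • v),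
        add_comm b a]
    refine ⟨a, b, (a ^ 2 + b ^ 2)⁻¹, by positivity, hab, ?_, ?_, ?_,
      ⟨((a + b) ^ 2 + b ^ 2)⁻¹, by positivity, ?_, ?_⟩,
      ⟨(a ^ 2 + (a + b) ^ 2)⁻¹, by positivity, ?_, ?_⟩⟩
    · rw [e1, div_eq_mul_inv]
    · rw [e2, div_eq_mul_inv]
    · rw [e3, div_eq_mul_inv]
    · rw [h.actSubsp_unipotent, one_mul, (h.projCoord_eq h1).2.1, div_eq_mul_inv]
    · rw [h.actSubsp_unipotent, one_mul, (h.projCoord_eq h1).2.2, div_eq_mul_inv]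
    · rw [hL, (h.projCoord_eq h2).2.1, div_eq_mul_inv]
    · rw [hL, (h.projCoord_eq h2).2.2, div_eq_mul_inv]
  have muu := measurable_projCoord u u
  have muv := measurable_projCoord u v
  have mvv := measurable_projCoord v v
  have mT : ∀ T : Set (Subsp d), MeasurableSet T →
      MeasurableSet {V : miniflag k F | (V : Subsp d) ∈ T} :=
    fun T hT => measurable_subtype_coe hT
  have mU : ∀ g : Mat d, ∀ T : Set (Subsp d), MeasurableSet T →
      MeasurableSet {V : miniflag k F | actSubsp g V ∈ T} :=
    fun g T hT => measurable_subtype_coe (measurable_actSubsp g hT)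
  have hmono : ∀ S T : Set (miniflag k F), S ⊆ T → ν.real S ≤ ν.real T :=
    fun S T hST => measureReal_mono hST
  -- On the miniflag these are: `ab > 0`, `ab < 0`, the parts `|a| < |b|` and `|b| < |a|` of `ab >
  -- 0`, the point `a = 0` and the point `b = 0`.
  let Tp : Set (Subsp d) := {V | 0 < projCoord u v V}
  let Tn : Set (Subsp d) := {V | projCoord u v V < 0}
  let S1 : Set (Subsp d) := {V | 0 < projCoord u v V ∧ projCoord u v V < projCoord v v V}
  let S2 : Set (Subsp d) := {V | 0 < projCoord u v V ∧ projCoord v v V < projCoord u v V}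
  let T0 : Set (Subsp d) := {V | projCoord u v V = 0 ∧ projCoord u u V = 0}
  let Ti : Set (Subsp d) := {V | projCoord u v V = 0 ∧ projCoord u u V ≠ 0}
  have hTp : MeasurableSet Tp := measurableSet_lt measurable_const muv
  have hTn : MeasurableSet Tn := measurableSet_lt muv measurable_const
  have hS1 : MeasurableSet S1 := hTp.inter (measurableSet_lt muv mvv)
  have hS2 : MeasurableSet S2 := hTp.inter (measurableSet_lt mvv muv)
  have hT0 : MeasurableSet T0 := (measurableSet_eq_fun muv measurable_const).inter
    (measurableSet_eq_fun muu measurable_const)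
  have hTi : MeasurableSet Ti := (measurableSet_eq_fun muv measurable_const).inter
    (measurableSet_eq_fun muu measurable_const).compl
  -- The two maps send `Tp` into its disjoint subsets `S1` and `S2`, so each of these has almost the
  -- full measure of `Tp`.
  have pos : ν.real {V | (V : Subsp d) ∈ Tp} ≤ 2 * δ := by
    have h1 := (abs_le.1 (hv S1 hS1)).1
    have h2 := (abs_le.1 (hu S2 hS2)).1
    have h3 : ν.real {V | (V : Subsp d) ∈ Tp} ≤
        ν.real {V | actSubsp (unipotent v u 1) V ∈ S1} := by
      refine hmono _ _ fun V hV => ?_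
      obtain ⟨a, b, c, hc, hab, e1, e2, e3, ⟨e, he, e4, e5⟩, ⟨e', he', e6, e7⟩⟩ := key V
      simp only [Tp, S1, Set.mem_ofPred_eq, e2, e6, e7] at hV ⊢
      have hab' : 0 < a * b := by by_contra hn; nlinarith
      constructor
      · have : 0 < a * (a + b) := by nlinarith [sq_nonneg a]
        positivity
      · apply mul_lt_mul_of_pos_right _ he'
        nlinarith [sq_nonneg a, sq_nonneg b, mul_self_nonneg b, pow_pos hab' 2, sq_pos_of_pos hab',
          sq_pos_of_ne_zero (show b ≠ 0 by rintro rfl; simp at hab')]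
    have h4 : ν.real {V | (V : Subsp d) ∈ Tp} ≤
        ν.real {V | actSubsp (unipotent u v 1) V ∈ S2} := by
      refine hmono _ _ fun V hV => ?_
      obtain ⟨a, b, c, hc, hab, e1, e2, e3, ⟨e, he, e4, e5⟩, ⟨e', he', e6, e7⟩⟩ := key V
      simp only [Tp, S2, Set.mem_ofPred_eq, e2, e4, e5] at hV ⊢
      have hab' : 0 < a * b := by by_contra hn; nlinarith
      constructor
      · have : 0 < (a + b) * b := by nlinarith [sq_nonneg b]
        positivity
      · apply mul_lt_mul_of_pos_right _ he
        nlinarith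
    have h5 : ν.real {V | (V : Subsp d) ∈ S1} + ν.real {V | (V : Subsp d) ∈ S2} ≤
        ν.real {V | (V : Subsp d) ∈ Tp} := by
      rw [← measureReal_union _ (mT _ hS2)]
      · refine hmono _ _ ?_
        rintro V (hV | hV)
        · exact hV.1
        · exact hV.1
      · rw [Set.disjoint_left]
        intro V hV hV'
        exact lt_asymm hV.2 hV'.2
    linarith
  -- Dually, the preimages of `Tn` under the two maps are disjoint subsets of `Tn`.
  have neg : ν.real {V | (V : Subsp d) ∈ Tn} ≤ 2 * δ := by
    have h1 := (abs_le.1 (hv Tn hTn)).2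
    have h2 := (abs_le.1 (hu Tn hTn)).2
    have h5 : ν.real {V | actSubsp (unipotent v u 1) V ∈ Tn} +
        ν.real {V | actSubsp (unipotent u v 1) V ∈ Tn} ≤ ν.real {V | (V : Subsp d) ∈ Tn} := by
      rw [← measureReal_union _ (mU _ _ hTn)]
      · refine hmono _ _ ?_
        rintro V (hV | hV)
        · obtain ⟨a, b, c, hc, hab, e1, e2, e3, ⟨e, he, e4, e5⟩, ⟨e', he', e6, e7⟩⟩ := key V
          simp only [Tn, Set.mem_ofPred_eq, e2, e6] at hV ⊢
          have : a * (a + b) < 0 := by by_contra hn; nlinarith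
          exact mul_neg_of_neg_of_pos (by nlinarith [sq_nonneg a]) hc
        · obtain ⟨a, b, c, hc, hab, e1, e2, e3, ⟨e, he, e4, e5⟩, ⟨e', he', e6, e7⟩⟩ := key V
          simp only [Tn, Set.mem_ofPred_eq, e2, e4] at hV ⊢
          have : (a + b) * b < 0 := by by_contra hn; nlinarith
          exact mul_neg_of_neg_of_pos (by nlinarith [sq_nonneg b]) hc
      · rw [Set.disjoint_left]
        intro V hV hV'
        obtain ⟨a, b, c, hc, hab, e1, e2, e3, ⟨e, he, e4, e5⟩, ⟨e', he', e6, e7⟩⟩ := key V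
        simp only [Tn, Set.mem_ofPred_eq, e4, e6] at hV hV'
        have : (a + b) * b < 0 := by by_contra hn; nlinarith
        have : a * (a + b) < 0 := by by_contra hn; nlinarith
        nlinarith [sq_nonneg (a + b)]
    linarith
  -- Each axis point is moved into `Tp` by one of the maps, which costs one more `δ`.
  have zero : ν.real {V | (V : Subsp d) ∈ T0} ≤ 3 * δ := by
    have h1 := (abs_le.1 (hu Tp hTp)).1
    have h3 : ν.real {V | (V : Subsp d) ∈ T0} ≤
        ν.real {V | actSubsp (unipotent u v 1) V ∈ Tp} := by
      refine hmono _ _ fun V hV => ?_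
      obtain ⟨a, b, c, hc, hab, e1, e2, e3, ⟨e, he, e4, e5⟩, ⟨e', he', e6, e7⟩⟩ := key V
      simp only [T0, Tp, Set.mem_ofPred_eq, e1, e4] at hV ⊢
      have ha : a = 0 := by simpa [hc.ne'] using hV.2
      subst ha
      apply mul_pos _ he
      nlinarith
    linarith
  have infty : ν.real {V | (V : Subsp d) ∈ Ti} ≤ 3 * δ := by
    have h1 := (abs_le.1 (hv Tp hTp)).1
    have h3 : ν.real {V | (V : Subsp d) ∈ Ti} ≤
        ν.real {V | actSubsp (unipotent v u 1) V ∈ Tp} := by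
      refine hmono _ _ fun V hV => ?_
      obtain ⟨a, b, c, hc, hab, e1, e2, e3, ⟨e, he, e4, e5⟩, ⟨e', he', e6, e7⟩⟩ := key V
      simp only [Ti, Tp, Set.mem_ofPred_eq, e1, e2, e6] at hV ⊢
      have ha : a ≠ 0 := fun ha => hV.2 (by simp [ha])
      have hb : b = 0 := by simpa [hc.ne', ha] using hV.1
      subst hb
      apply mul_pos _ he'
      nlinarith
    linarith
  have cover : ν.real Set.univ ≤ ν.real ({V | (V : Subsp d) ∈ Tp} ∪ {V | (V : Subsp d) ∈ Tn} ∪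
      {V | (V : Subsp d) ∈ T0} ∪ {V | (V : Subsp d) ∈ Ti}) := by
    refine hmono _ _ fun V _ => ?_
    rcases lt_trichotomy (projCoord u v (V : Subsp d)) 0 with h1 | h1 | h1
    · exact Or.inl (Or.inl (Or.inr h1))
    · by_cases h2 : projCoord u u (V : Subsp d) = 0
      · exact Or.inl (Or.inr ⟨h1, h2⟩)
      · exact Or.inr ⟨h1, h2⟩
    · exact Or.inl (Or.inl (Or.inl h1))
  rw [probReal_univ] at cover
  have u1 := measureReal_union_le (μ := ν) ({V | (V : Subsp d) ∈ Tp} ∪ {V | (V : Subsp d) ∈ Tn} ∪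
      {V | (V : Subsp d) ∈ T0}) {V | (V : Subsp d) ∈ Ti}
  have u2 := measureReal_union_le (μ := ν) ({V | (V : Subsp d) ∈ Tp} ∪ {V | (V : Subsp d) ∈ Tn})
      {V | (V : Subsp d) ∈ T0}
  have u3 := measureReal_union_le (μ := ν) {V | (V : Subsp d) ∈ Tp} {V | (V : Subsp d) ∈ Tn}
  linarith

theorem abs_sub_le_of_unipotent_iterate {d k : ℕ} {F : Subsp d × Subsp d}
    {u v : EuclideanSpace ℝ (Fin d)} (huv : inner ℝ u v = 0)
    (ν : Measure (miniflag k F)) {t δ : ℝ}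
    (h : ∀ T : Set (Subsp d), MeasurableSet T → |ν.real {V | (V : Subsp d) ∈ T} -
      ν.real {V | actSubsp (unipotent u v t) V ∈ T}| ≤ δ) (n : ℕ) :
    ∀ T : Set (Subsp d), MeasurableSet T → |ν.real {V | (V : Subsp d) ∈ T} -
      ν.real {V | actSubsp (unipotent u v (n * t)) V ∈ T}| ≤ n * δ := by
  induction n with
  | zero => intro T _; simp [unipotent_zero, actSubsp_one]
  | succ n ih =>
    intro T hT
    have h1 := ih T hT
    have h2 := h {W | actSubsp (unipotent u v (n * t)) W ∈ T} (measurable_actSubsp _ hT)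
    simp only [Set.mem_ofPred_eq, ← actSubsp_mul, unipotent_mul huv] at h2
    rw [Nat.cast_succ, add_mul, one_mul, add_mul, one_mul]
    exact (abs_sub_le _ _ _).trans (add_le_add h1 h2)

/-! ### Comparison of conditional laws -/

/-- Since `X ∘ g = X`, restricting and pushing by `g` commutes with disintegration along `X`. The
pushed measure has a density `ρ ≤ K` with respect to `μ`, so its disintegration is also `ρ` times
the conditional laws. Uniqueness of disintegrations identifies the two. -/
theorem condDistrib_restrict_map_le {Ω β : Type*} [MeasurableSpace Ω] [StandardBorelSpace Ω]
    [Nonempty Ω] [MeasurableSpace β] (μ : Measure Ω) [IsFiniteMeasure μ] {X : Ω → β}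
    (hX : Measurable X) {g : Ω → Ω} (hg : Measurable g) (hXg : ∀ ω, X (g ω) = X ω) {R : Set Ω}
    (hR : MeasurableSet R) {K : ℝ≥0∞} (hK : K ≠ ∞) (h : (μ.restrict R).map g ≤ K • μ) :
    ∀ᵐ b ∂(μ.map X), ((condDistrib (fun ω => ω) X μ b).restrict R).map g ≤
      K • condDistrib (fun ω => ω) X μ b := by
  set κ := condDistrib (fun ω => ω) X μ with hκ
  have hfin : IsFiniteMeasure (K • μ) := Measure.smul_finite μ hK
  set ξ := (μ.restrict R).map g with hξ
  have hac : ξ ≪ K • μ := Measure.absolutelyContinuous_of_le h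
  -- The truncation makes `ρ ≤ K` hold everywhere rather than almost everywhere, hence under every
  -- conditional law.
  set ρ : Ω → ℝ≥0∞ := fun ω => K * min (ξ.rnDeriv (K • μ) ω) 1 with hρ
  have hρm : Measurable ρ := ((Measure.measurable_rnDeriv _ _).min measurable_const).const_mul K
  have hρK : ∀ ω, ρ ω ≤ K := fun ω => by
    calc K * min (ξ.rnDeriv (K • μ) ω) 1 ≤ K * 1 := by gcongr; exact min_le_right _ _
      _ = K := mul_one K
  have hξρ : ξ = μ.withDensity ρ := by
    have h1 : ξ = (K • μ).withDensity fun ω => min (ξ.rnDeriv (K • μ) ω) 1 := by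
      conv_lhs => rw [← Measure.withDensity_rnDeriv_eq _ _ hac]
      apply withDensity_congr_ae
      filter_upwards [Measure.rnDeriv_le_one_of_le h] with ω hω
      exact (min_eq_left hω).symm
    rw [h1, withDensity_smul_measure, ← withDensity_smul _
      ((Measure.measurable_rnDeriv _ _).min measurable_const)]
    rfl
  have hfd : IsFiniteKernel (κ.withDensity fun _ => ρ) :=
    Kernel.isFiniteKernel_withDensity_of_bounded κ hK fun _ => hρK
  have hρu : Measurable (Function.uncurry fun (_ : β) ω => ρ ω) := hρm.comp measurable_snd
  have hXi : Measurable fun ω => (X ω, ω) := hX.prodMk measurable_id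
  have hcd : (μ.map X) ⊗ₘ κ = μ.map fun ω => (X ω, ω) :=
    compProd_map_condDistrib (X := X) (Y := fun ω => ω) aemeasurable_id
  have heq : (μ.map X) ⊗ₘ (κ.withDensity fun _ => ρ) = (μ.map X) ⊗ₘ ((κ.restrict hR).map g) := by
    rw [Measure.compProd_withDensity hρu, hcd]
    ext s hs
    have h1 : ((μ.map fun ω => (X ω, ω)).withDensity fun p => ρ p.2) s =
        ξ ((fun ω => (X ω, ω)) ⁻¹' s) := by
      have hρ2 : Measurable fun p : β × Ω => ρ p.2 := hρm.comp measurable_snd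
      rw [withDensity_apply _ hs, setLIntegral_map hs hρ2 hXi, hξρ, withDensity_apply _ (hXi hs)]
    have h2 : ((μ.map X) ⊗ₘ ((κ.restrict hR).map g)) s =
        ((μ.map X) ⊗ₘ κ) {p | p.2 ∈ R ∧ (p.1, g p.2) ∈ s} := by
      have hm : MeasurableSet {p : β × Ω | p.2 ∈ R ∧ (p.1, g p.2) ∈ s} :=
        (measurable_snd hR).inter ((measurable_fst.prodMk (hg.comp measurable_snd)) hs)
      rw [Measure.compProd_apply hs, Measure.compProd_apply hm]
      refine lintegral_congr fun b => ?_
      rw [Kernel.map_apply' _ hg _ (measurable_prodMk_left hs), Kernel.restrict_apply,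
        Measure.restrict_apply (hg (measurable_prodMk_left hs))]
      congr 1
      ext ω
      exact and_comm
    have hm : MeasurableSet {p : β × Ω | p.2 ∈ R ∧ (p.1, g p.2) ∈ s} :=
        (measurable_snd hR).inter ((measurable_fst.prodMk (hg.comp measurable_snd)) hs)
    rw [h1, h2, hcd, Measure.map_apply hXi hm, hξ, Measure.map_apply hg (hXi hs),
      Measure.restrict_apply (hg (hXi hs))]
    congr 1
    ext ω
    simp only [Set.mem_inter_iff, Set.mem_preimage, hXg]
    exact and_comm
  have : IsFiniteKernel ((κ.restrict hR).map g) := inferInstance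
  filter_upwards [Kernel.ae_eq_of_compProd_eq heq] with b hb
  rw [Kernel.map_apply _ hg, Kernel.restrict_apply, Kernel.withDensity_apply _ hρu] at hb
  rw [← hb, ← withDensity_const]
  exact withDensity_mono (Filter.Eventually.of_forall hρK)

theorem condDistrib_ae_ae {Ω β : Type*} [MeasurableSpace Ω] [StandardBorelSpace Ω]
    [Nonempty Ω] [MeasurableSpace β] (μ : Measure Ω) [IsFiniteMeasure μ] {X : Ω → β}
    (hX : Measurable X) {p : Ω → Prop} (hp : MeasurableSet {ω | p ω}) (h : ∀ᵐ ω ∂μ, p ω) :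
    ∀ᵐ b ∂(μ.map X), ∀ᵐ ω ∂(condDistrib (fun ω => ω) X μ b), p ω := by
  have hcd : (μ.map X) ⊗ₘ condDistrib (fun ω => ω) X μ = μ.map fun ω => (X ω, ω) :=
    compProd_map_condDistrib (X := X) (Y := fun ω => ω) aemeasurable_id
  apply Measure.ae_ae_of_ae_compProd (p := fun x => p x.2)
  rw [hcd]
  exact (ae_map_iff (hX.prodMk measurable_id).aemeasurable (measurable_snd hp)).2 h

theorem lintegral_condDistrib {Ω β : Type*} [MeasurableSpace Ω] [StandardBorelSpace Ω]
    [Nonempty Ω] [MeasurableSpace β] (μ : Measure Ω) [IsFiniteMeasure μ] {X : Ω → β}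
    (hX : Measurable X) {R : Set Ω} (hR : MeasurableSet R) :
    ∫⁻ b, condDistrib (fun ω => ω) X μ b R ∂(μ.map X) = μ R := by
  have h := setLIntegral_preimage_condDistrib (μ := μ) hX (Y := fun ω => ω) aemeasurable_id
    (s := R) (t := Set.univ) hR MeasurableSet.univ
  rw [lintegral_map (Kernel.measurable_coe _ hR) hX]
  simpa using h

/-! ### The entropy of a single miniflag -/

/-- Testing both measures on the preimage of `T` under `B⁻¹` removes `B`: the two masses become
those of `T` under `ν` and under `g_* ν`. -/
theorem sq_sub_le_klDiv_add_klDiv_actMiniflag {d k : ℕ} {F : Subsp d × Subsp d}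
    (ν : Measure (miniflag k F)) [IsProbabilityMeasure ν] (m : Measure (Subsp d))
    (hm : m Set.univ ≤ 1) {B : Mat d} (hB : IsUnit B) (g : Mat d) {T : Set (Subsp d)}
    (hT : MeasurableSet T) :
    ENNReal.ofReal ((ν.real {V | (V : Subsp d) ∈ T} - ν.real {V | actSubsp g V ∈ T}) ^ 2 / 8) ≤
      InformationTheory.klDiv (ν.map (actMiniflag k F B)) m +
        InformationTheory.klDiv (ν.map (actMiniflag k F (B * g))) m := by
  obtain ⟨C, rfl⟩ := hB
  have hmeas : ∀ A : Mat d, Measurable (actMiniflag k F A) := fun A =>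
    (measurable_actSubsp A).comp measurable_subtype_coe
  have hp : ∀ A : Mat d, IsProbabilityMeasure (ν.map (actMiniflag k F A)) := fun A =>
    Measure.isProbabilityMeasure_map (hmeas A).aemeasurable
  have hS : MeasurableSet (actSubsp (↑C⁻¹ : Mat d) ⁻¹' T) := measurable_actSubsp _ hT
  have hi : ∀ V, actSubsp (↑C⁻¹ : Mat d) (actSubsp (C : Mat d) V) = V := fun V => by
    rw [← actSubsp_mul, Units.inv_mul, actSubsp_one]
  have h := sq_sub_le_klDiv_add_klDiv (ν.map (actMiniflag k F C))
    (ν.map (actMiniflag k F (C * g))) m hm hS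
  rw [map_measureReal_apply (hmeas _) hS, map_measureReal_apply (hmeas _) hS] at h
  have e1 : actMiniflag k F (C : Mat d) ⁻¹' (actSubsp (↑C⁻¹ : Mat d) ⁻¹' T) =
      {V : miniflag k F | (V : Subsp d) ∈ T} := by
    ext V
    simp only [Set.mem_preimage, actMiniflag, hi, Set.mem_ofPred_eq]
  have e2 : actMiniflag k F (C * g : Mat d) ⁻¹' (actSubsp (↑C⁻¹ : Mat d) ⁻¹' T) =
      {V : miniflag k F | actSubsp g V ∈ T} := by
    ext V
    simp only [Set.mem_preimage, actMiniflag, actSubsp_mul, hi, Set.mem_ofPred_eq]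
  rwa [e1, e2] at h

/-- The two-point bound is integrated over `R`. The terms at `B` contribute at most `Φ`, and those
at `B g` at most `K Φ` by the domination hypothesis. -/
theorem mul_le_furstenbergEntropy {d k : ℕ} {F : Subsp d × Subsp d} (κ : Measure (Mat d))
    [IsProbabilityMeasure κ] (hκ : ∀ᵐ B ∂κ, IsUnit B) {R : Set (Mat d)}
    {K : ℝ≥0∞} {g : Mat d} (hg : (κ.restrict R).map (fun B => B * g) ≤ K • κ)
    (ν : Measure (miniflag k F)) [IsProbabilityMeasure ν] {T : Set (Subsp d)}
    (hT : MeasurableSet T) :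
    ENNReal.ofReal ((ν.real {V | (V : Subsp d) ∈ T} - ν.real {V | actSubsp g V ∈ T}) ^ 2 / 8) *
      κ R ≤ (1 + K) * furstenbergEntropy κ (actMiniflag k F) ν := by
  set m := meanPushforward κ (actMiniflag k F) ν with hm
  have hm1 : m Set.univ ≤ 1 := meanPushforward_univ_le κ _ ν
  have : IsFiniteMeasure m := ⟨hm1.trans_lt ENNReal.one_lt_top⟩
  set Q : Mat d → ℝ≥0∞ := fun B => InformationTheory.klDiv (ν.map (actMiniflag k F B)) m with hQ
  have hQm : Measurable Q := by
    refine measurable_klDiv_map (f := actMiniflag k F) ?_ ν m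
    have h1 : Measurable fun p : Mat d × miniflag k F => (p.1, (p.2 : Subsp d)) :=
      measurable_fst.prodMk (measurable_subtype_coe.comp measurable_snd)
    have h2 := (measurable_actSubsp_uncurry d).comp h1
    exact h2
  have hgm : Measurable fun B : Mat d => B * g := by
    have : Continuous fun B : Mat d => B * g := by fun_prop
    exact this.measurable
  calc _ = ∫⁻ _ in R, ENNReal.ofReal ((ν.real {V | (V : Subsp d) ∈ T} -
          ν.real {V | actSubsp g V ∈ T}) ^ 2 / 8) ∂κ := by rw [setLIntegral_const]
    _ ≤ ∫⁻ B in R, (Q B + Q (B * g)) ∂κ := by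
        apply lintegral_mono_ae
        filter_upwards [ae_restrict_of_ae hκ] with B hB
        exact sq_sub_le_klDiv_add_klDiv_actMiniflag ν m hm1 hB g hT
    _ = ∫⁻ B in R, Q B ∂κ + ∫⁻ B, Q B ∂((κ.restrict R).map fun B => B * g) := by
        rw [lintegral_add_left hQm, lintegral_map hQm hgm]
    _ ≤ ∫⁻ B, Q B ∂κ + ∫⁻ B, Q B ∂(K • κ) :=
        add_le_add (setLIntegral_le_lintegral _ _) (lintegral_mono' hg le_rfl)
    _ = _ := by
        rw [lintegral_smul_measure, add_mul, one_mul, smul_eq_mul]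
        rfl

theorem le_pushforwardEntropy_actMiniflag {d k : ℕ} {F : Subsp d × Subsp d} (hF : F ∈ PF d k)
    {u v : EuclideanSpace ℝ (Fin d)} (h : IsMiniflagFrame F u v) (κ : Measure (Mat d))
    [IsProbabilityMeasure κ] (hκ : ∀ᵐ B ∂κ, IsUnit B) {R : Set (Mat d)}
    {K : ℝ} (hK : 0 ≤ K) {n : ℕ} (hn : 0 < n)
    (hu : (κ.restrict R).map (fun B => B * unipotent u v (n : ℝ)⁻¹) ≤ ENNReal.ofReal K • κ)
    (hv : (κ.restrict R).map (fun B => B * unipotent v u (n : ℝ)⁻¹) ≤ ENNReal.ofReal K • κ) :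
    ENNReal.ofReal (1 / (800 * (1 + K) * n ^ 2)) * κ R ≤
      pushforwardEntropy κ (actMiniflag k F) := by
  refine le_iInf fun ν => ?_
  set Φ := furstenbergEntropy κ (actMiniflag k F) (ν : Measure (miniflag k F)) with hΦ
  by_cases htop : Φ = ∞
  · rw [htop]; exact le_top
  by_cases hR0 : κ R = 0
  · simp [hR0]
  have hRpos : 0 < κ.real R := ENNReal.toReal_pos hR0 (measure_ne_top _ _)
  -- The almost-invariance that `mul_le_furstenbergEntropy` gives. Then `1 ≤ 10 n δ`, once squared,
  -- yields the constant `800 = 8 · 10²`.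
  set δ := Real.sqrt (8 * ((1 + K) * Φ.toReal) / κ.real R) with hδ
  have hn' : (0 : ℝ) < n := Nat.cast_pos.2 hn
  have hΦ0 : 0 ≤ Φ.toReal := ENNReal.toReal_nonneg
  have hδ2 : δ ^ 2 = 8 * ((1 + K) * Φ.toReal) / κ.real R := Real.sq_sqrt (by positivity)
  have step : ∀ g : Mat d, (κ.restrict R).map (fun B => B * g) ≤ ENNReal.ofReal K • κ →
      ∀ T : Set (Subsp d), MeasurableSet T →
        |(ν : Measure (miniflag k F)).real {V | (V : Subsp d) ∈ T} -
          (ν : Measure (miniflag k F)).real {V | actSubsp g V ∈ T}| ≤ δ := by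
    intro g hg T hT
    have h1 := mul_le_furstenbergEntropy κ hκ hg (ν : Measure (miniflag k F)) hT
    rw [← hΦ] at h1
    have h2 := ENNReal.toReal_mono (ENNReal.mul_ne_top (by simp) htop) h1
    rw [ENNReal.toReal_mul, ENNReal.toReal_mul, ENNReal.toReal_ofReal (by positivity),
      ENNReal.toReal_add (by simp) (by simp), ENNReal.toReal_ofReal hK, ENNReal.toReal_one] at h2
    apply abs_le_of_sq_le_sq _ (Real.sqrt_nonneg _)
    rw [hδ2, le_div_iff₀ hRpos]
    change _ / 8 * κ.real R ≤ _ at h2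
    linarith
  have hnn : (n : ℝ) * (n : ℝ)⁻¹ = 1 := mul_inv_cancel₀ hn'.ne'
  have h1 := abs_sub_le_of_unipotent_iterate h.inner_eq_zero _ (step _ hu) n
  have h2 := abs_sub_le_of_unipotent_iterate h.symm.inner_eq_zero _ (step _ hv) n
  rw [hnn] at h1 h2
  have h3 := one_le_of_almost_invariant hF h _ h1 h2
  have h4 : κ.real R ≤ 800 * (1 + K) * n ^ 2 * Φ.toReal := by
    have : 1 ≤ (10 * (n * δ)) ^ 2 := by nlinarith
    rw [mul_pow, mul_pow, hδ2] at this
    rw [← mul_div_assoc, ← mul_div_assoc, le_div_iff₀ hRpos] at this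
    linarith
  rw [← ENNReal.ofReal_toReal htop, ← ENNReal.ofReal_toReal (measure_ne_top κ R),
    ← ENNReal.ofReal_mul (by positivity)]
  apply ENNReal.ofReal_le_ofReal
  rw [one_div, inv_mul_le_iff₀ (by positivity)]
  exact h4

/-! ### Lebesgue measure on matrices -/

theorem matLebesgue_eq (d : ℕ) : matLebesgue d = (volume : Measure (Fin d → Fin d → ℝ)) :=
  Measure.map_id

instance (d : ℕ) : SigmaFinite (matLebesgue d) := by
  rw [matLebesgue_eq]
  exact inferInstanceAs (SigmaFinite (volume : Measure (Fin d → Fin d → ℝ)))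

theorem matLebesgue_pos_of_isOpen {d : ℕ} {U : Set (Mat d)} (hU : IsOpen U) (hne : U.Nonempty) :
    0 < matLebesgue d U := by
  rw [matLebesgue_eq]
  exact IsOpen.measure_pos (X := Fin d → Fin d → ℝ) volume hU hne

theorem measurePreserving_mat_add {d : ℕ} (c : Mat d) :
    MeasurePreserving (fun E : Mat d => E + c) (matLebesgue d) (matLebesgue d) := by
  rw [matLebesgue_eq]
  exact measurePreserving_add_right (volume : Measure (Fin d → Fin d → ℝ)) c

theorem measurePreserving_mat_mul {d : ℕ} {g : Mat d} (hg : g.det = 1) :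
    MeasurePreserving (fun E : Mat d => E * g) (matLebesgue d) (matLebesgue d) := by
  have h1 : MeasurePreserving (Matrix.toLin' g.transpose) := by
    refine ⟨(LinearMap.continuous_of_finiteDimensional _).measurable, ?_⟩
    rw [Real.map_matrix_volume_pi_eq_smul_volume_pi (by rw [Matrix.det_transpose, hg]; simp),
      Matrix.det_transpose, hg]
    simp
  have h2 := volume_preserving_pi (fun _ : Fin d => h1)
  have h3 : (fun E : Mat d => E * g) =
      fun (E : Fin d → Fin d → ℝ) i => Matrix.toLin' g.transpose (E i) := by
    funext E
    refine Matrix.ext fun i j => ?_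
    simp [Matrix.mul_apply, Matrix.mulVec, dotProduct, mul_comm]
  rw [matLebesgue_eq, h3]
  exact h2

/-- On each line `B + t • 1` the determinant vanishes only at the finitely many roots of a
characteristic polynomial, so Fubini gives a null set of pairs `(B, t)`. By translation invariance
all slices in `t` have the same measure, which must then be zero. -/
theorem ae_isUnit_matLebesgue (d : ℕ) : ∀ᵐ B ∂(matLebesgue d), IsUnit B := by
  have hdet : Continuous fun B : Mat d => B.det := continuous_id.matrix_det
  have hs : MeasurableSet {B : Mat d | B.det = 0} :=
    hdet.measurable (measurableSet_singleton 0)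
  have hc : Continuous fun p : Mat d × ℝ => (p.1 + p.2 • (1 : Mat d)).det := by fun_prop
  have hP : MeasurableSet {p : Mat d × ℝ | (p.1 + p.2 • (1 : Mat d)).det = 0} :=
    hc.measurable (measurableSet_singleton 0)
  have h1 : ((matLebesgue d).prod volume) {p : Mat d × ℝ | (p.1 + p.2 • (1 : Mat d)).det = 0} =
      0 := by
    rw [Measure.measure_prod_null hP]
    refine Filter.Eventually.of_forall fun B => Set.Finite.measure_zero ?_ _
    have : Prod.mk B ⁻¹' {p : Mat d × ℝ | (p.1 + p.2 • (1 : Mat d)).det = 0} ⊆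
        {t : ℝ | (-B).charpoly.IsRoot t} := by
      intro t ht
      have ht' : (B + t • (1 : Mat d)).det = 0 := ht
      simp only [Set.mem_ofPred_eq, Polynomial.IsRoot.def, Matrix.eval_charpoly, sub_neg_eq_add]
      rw [add_comm, ← ht', Matrix.scalar_apply, ← Matrix.smul_one_eq_diagonal]
    exact (Polynomial.finite_setOfPred_isRoot (Matrix.charpoly_monic _).ne_zero).subset this
  rw [Measure.prod_apply_symm hP] at h1
  have h2 : ∀ t : ℝ, matLebesgue d ((fun B => (B, t)) ⁻¹'
      {p : Mat d × ℝ | (p.1 + p.2 • (1 : Mat d)).det = 0}) =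
        matLebesgue d {B : Mat d | B.det = 0} := fun t =>
    (measurePreserving_mat_add (t • (1 : Mat d))).measure_preimage hs.nullMeasurableSet
  simp_rw [h2] at h1
  rw [lintegral_const, mul_eq_zero] at h1
  have h3 := h1.resolve_right (by simp)
  rw [ae_iff]
  convert h3 using 2
  ext B
  simp [Matrix.isUnit_iff_isUnit_det]

theorem ae_isUnit_add_smul {d : ℕ} (A : Mat d) {ε : ℝ} (hε : ε ≠ 0) :
    ∀ᵐ E ∂(matLebesgue d), IsUnit (A + ε • E) := by
  have h := (measurePreserving_mat_add (ε⁻¹ • A)).quasiMeasurePreserving.ae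
    (ae_isUnit_matLebesgue d)
  filter_upwards [h] with E hE
  have h1 : A + ε • E = ε • (E + ε⁻¹ • A) := by
    rw [smul_add, smul_smul, mul_inv_cancel₀ hε, one_smul, add_comm]
  rw [h1]
  exact (isUnit_smul_iff (Units.mk0 ε hε) _).2 hE

theorem measurableSet_isUnit_mat (d : ℕ) : MeasurableSet {B : Mat d | IsUnit B} := by
  have hdet : Continuous fun B : Mat d => B.det := continuous_id.matrix_det
  simp_rw [Matrix.isUnit_iff_isUnit_det, isUnit_iff_ne_zero]
  exact hdet.measurable (measurableSet_singleton 0).compl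

theorem map_restrict_withDensity_le {X : Type*} [MeasurableSpace X] (L : Measure X) [SFinite L]
    (f : X → ℝ≥0∞) {ψ : X → X} (hψ : MeasurePreserving ψ L L) {W₀ W : Set X}
    (hW₀ : MeasurableSet W₀) (hW : MeasurableSet W) (hmaps : ∀ x ∈ W₀, ψ x ∈ W)
    {c₀ c₁ K : ℝ≥0∞} (h1 : ∀ x ∈ W₀, f x ≤ c₁) (h0 : ∀ x ∈ W, c₀ ≤ f x) (hK : c₁ ≤ K * c₀) :
    ((L.withDensity f).restrict W₀).map ψ ≤ K • L.withDensity f := by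
  refine Measure.le_iff.2 fun S hS => ?_
  rw [Measure.map_apply hψ.measurable hS, Measure.restrict_apply (hψ.measurable hS),
    withDensity_apply' _ _, Measure.smul_apply, withDensity_apply' _ _, smul_eq_mul]
  calc ∫⁻ x in ψ ⁻¹' S ∩ W₀, f x ∂L ≤ ∫⁻ _ in ψ ⁻¹' S ∩ W₀, c₁ ∂L :=
        setLIntegral_mono' ((hψ.measurable hS).inter hW₀) fun x hx => h1 x hx.2
    _ = c₁ * L (ψ ⁻¹' S ∩ W₀) := setLIntegral_const _ _
    _ ≤ c₁ * L (ψ ⁻¹' (S ∩ W)) := by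
        gcongr
        exact fun x hx => ⟨hx.1, hmaps x hx.2⟩
    _ = c₁ * L (S ∩ W) := by rw [hψ.measure_preimage (hS.inter hW).nullMeasurableSet]
    _ ≤ K * c₀ * L (S ∩ W) := by gcongr
    _ = K * ∫⁻ _ in S ∩ W, c₀ ∂L := by rw [setLIntegral_const, mul_assoc]
    _ ≤ K * ∫⁻ x in S ∩ W, f x ∂L := by
        gcongr K * ?_
        exact setLIntegral_mono' (hS.inter hW) fun x hx => h0 x hx.2
    _ ≤ K * ∫⁻ x in S, f x ∂L := by
        gcongr
        exact Set.inter_subset_left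

/-! ### Perturbations of a matrix by an absolutely continuous noise -/

theorem opNorm_nonneg {d : ℕ} (A : Mat d) : 0 ≤ opNorm A := norm_nonneg _

theorem opNorm_add_le {d : ℕ} (A B : Mat d) : opNorm (A + B) ≤ opNorm A + opNorm B := by
  unfold opNorm
  rw [map_add]
  exact norm_add_le _ _

theorem opNorm_smul {d : ℕ} (t : ℝ) (A : Mat d) : opNorm (t • A) = |t| * opNorm A := by
  unfold opNorm
  rw [map_smul, norm_smul, Real.norm_eq_abs]

theorem opNorm_mul_le {d : ℕ} (A B : Mat d) : opNorm (A * B) ≤ opNorm A * opNorm B := by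
  unfold opNorm
  rw [map_mul]
  exact norm_mul_le _ _

theorem continuous_opNorm (d : ℕ) : Continuous (opNorm : Mat d → ℝ) :=
  (continuous_toEuclideanCLM d).norm

theorem opNorm_unipotent_sub_one_le {d : ℕ} {u v : EuclideanSpace ℝ (Fin d)} (hu : ‖u‖ = 1)
    (hv : ‖v‖ = 1) (t : ℝ) : opNorm (unipotent u v t - 1) ≤ |t| := by
  refine ContinuousLinearMap.opNorm_le_bound _ (abs_nonneg t) fun x => ?_
  have h : Matrix.toEuclideanCLM (n := Fin d) (𝕜 := ℝ) (unipotent u v t - 1) x =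
      (t * inner ℝ v x) • u := by
    have h1 : Matrix.toEuclideanCLM (n := Fin d) (𝕜 := ℝ) (unipotent u v t) x =
      x + (t * inner ℝ v x) • u := toEuclideanLin_unipotent u v t x
    rw [map_sub, map_one, _root_.sub_apply, h1]
    simp
  rw [h, norm_smul, hu, mul_one, norm_mul, Real.norm_eq_abs]
  gcongr
  have := norm_inner_le_norm (𝕜 := ℝ) v x
  rwa [hv, one_mul] at this

theorem exists_opNorm_ball_subset {d : ℕ} {U : Set (Mat d)} (hU : IsOpen U) {E₀ : Mat d}
    (hE₀ : E₀ ∈ U) : ∃ r > 0, ∀ E : Mat d, opNorm (E - E₀) < r → E ∈ U := by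
  have h1 := hU.preimage (continuous_toEuclideanCLM_symm d)
  obtain ⟨r, hr, h⟩ := Metric.isOpen_iff.1 h1
    (Matrix.toEuclideanCLM (n := Fin d) (𝕜 := ℝ) E₀) (by simpa using hE₀)
  refine ⟨r, hr, fun E hE => ?_⟩
  have h2 : Matrix.toEuclideanCLM (n := Fin d) (𝕜 := ℝ) E ∈
      Metric.ball (Matrix.toEuclideanCLM (n := Fin d) (𝕜 := ℝ) E₀) r := by
    rw [mem_ball_iff_norm, ← map_sub]
    exact hE
  simpa using h h2

theorem isOpen_opNorm_ball {d : ℕ} (E₀ : Mat d) (r : ℝ) :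
    IsOpen {E : Mat d | opNorm (E - E₀) < r} :=
  isOpen_lt ((continuous_opNorm d).comp (continuous_id.sub continuous_const)) continuous_const

theorem exists_bounds_on_opNorm_ball {d : ℕ} {φ : Mat d → ℝ} (hφ_cont : Continuous φ)
    (η : Measure (Mat d)) [IsProbabilityMeasure η]
    (hη : η = (matLebesgue d).withDensity fun A => ENNReal.ofReal (φ A)) :
    ∃ (E₀ : Mat d) (c r : ℝ), 0 < c ∧ 0 < r ∧
      ∀ E : Mat d, opNorm (E - E₀) < r → c ≤ φ E ∧ φ E ≤ 4 * c := by
  obtain ⟨E₀, hE₀⟩ : ∃ E, 0 < φ E := by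
    by_contra! hn
    have h1 : η Set.univ = 0 := by
      rw [hη, withDensity_apply _ MeasurableSet.univ]
      simp [ENNReal.ofReal_of_nonpos (hn _)]
    simp at h1
  have hU : IsOpen {E | φ E₀ / 2 < φ E ∧ φ E < 2 * φ E₀} :=
    (isOpen_lt continuous_const hφ_cont).inter (isOpen_lt hφ_cont continuous_const)
  obtain ⟨r, hr, h⟩ := exists_opNorm_ball_subset hU (E₀ := E₀)
    ⟨by linarith, by linarith⟩
  -- Here `φ` lies between `φ E₀ / 2` and `2 * φ E₀`. This ratio is the source of the domination
  -- constant `4`.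
  refine ⟨E₀, φ E₀ / 2, r, by linarith, hr, fun E hE => ?_⟩
  obtain ⟨h1, h2⟩ := h E hE
  exact ⟨h1.le, by linarith⟩

theorem map_restrict_mul_unipotent_le {d : ℕ} {φ : Mat d → ℝ}
    (η : Measure (Mat d)) [IsProbabilityMeasure η]
    (hη : η = (matLebesgue d).withDensity fun A => ENNReal.ofReal (φ A))
    {E₀ : Mat d} {c r : ℝ} (hr : 0 < r)
    (hφ : ∀ E : Mat d, opNorm (E - E₀) < r → c ≤ φ E ∧ φ E ≤ 4 * c)
    {A : Mat d} {ε t M : ℝ} (hε : 0 < ε) (ht : 0 ≤ t) (hA : opNorm A ≤ M)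
    (htr : t * (opNorm E₀ + r + M / ε) ≤ r / 2)
    {u v : EuclideanSpace ℝ (Fin d)} (hu : ‖u‖ = 1) (hv : ‖v‖ = 1) (huv : inner ℝ u v = 0) :
    ((η.map fun E => A + ε • E).restrict
      {B | opNorm (ε⁻¹ • (B - A) - E₀) < r / 2}).map (fun B => B * unipotent u v t) ≤
        ENNReal.ofReal 4 • η.map fun E => A + ε • E := by
  set g := unipotent u v t with hg
  set W₀ : Set (Mat d) := {E | opNorm (E - E₀) < r / 2} with hW₀
  have hτ : Measurable fun E : Mat d => A + ε • E := by
    have : Continuous fun E : Mat d => A + ε • E := by fun_prop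
    exact this.measurable
  have hgm : Measurable fun B : Mat d => B * g := by
    have : Continuous fun B : Mat d => B * g := by fun_prop
    exact this.measurable
  have hψ : MeasurePreserving (fun E : Mat d => E * g + ε⁻¹ • (A * g - A))
      (matLebesgue d) (matLebesgue d) :=
    (measurePreserving_mat_add (ε⁻¹ • (A * g - A))).comp
      (measurePreserving_mat_mul (det_unipotent huv t))
  have hR : MeasurableSet {B : Mat d | opNorm (ε⁻¹ • (B - A) - E₀) < r / 2} := by
    have : Continuous fun B : Mat d => ε⁻¹ • (B - A) := by fun_prop
    exact ((isOpen_opNorm_ball E₀ (r / 2)).preimage this).measurableSet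
  have hpre : (fun E : Mat d => A + ε • E) ⁻¹' {B | opNorm (ε⁻¹ • (B - A) - E₀) < r / 2} =
      W₀ := by
    ext E
    simp only [Set.mem_preimage, Set.mem_ofPred_eq, hW₀, add_sub_cancel_left, smul_smul,
      inv_mul_cancel₀ hε.ne', one_smul]
  have hmaps : ∀ E ∈ W₀, E * g + ε⁻¹ • (A * g - A) ∈ {E : Mat d | opNorm (E - E₀) < r} := by
    intro E hE
    have hE' : opNorm (E - E₀) < r / 2 := hE
    -- The displacement is `(E + ε⁻¹ A)(g - 1)`, of norm at most `t (‖E₀‖ + r + M / ε) ≤ r / 2`, so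
    -- the half ball stays in the ball.
    have h1 : E * g + ε⁻¹ • (A * g - A) - E₀ = (E - E₀) + ((E - E₀) + E₀ + ε⁻¹ • A) * (g - 1) := by
      rw [sub_add_cancel, mul_sub, add_mul, smul_mul_assoc, mul_one, smul_sub]
      abel
    have h2 : opNorm ((E - E₀) + E₀ + ε⁻¹ • A) ≤ opNorm E₀ + r + M / ε := by
      have a1 := opNorm_add_le ((E - E₀) + E₀) (ε⁻¹ • A)
      have a2 := opNorm_add_le (E - E₀) E₀
      rw [opNorm_smul, abs_of_pos (inv_pos.2 hε)] at a1
      have a3 : ε⁻¹ * opNorm A ≤ M / ε := by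
        rw [div_eq_inv_mul]
        gcongr
      linarith
    have h3 : opNorm (g - 1) ≤ t := by
      simpa [abs_of_nonneg ht] using opNorm_unipotent_sub_one_le hu hv t
    have h4 := opNorm_mul_le ((E - E₀) + E₀ + ε⁻¹ • A) (g - 1)
    have h5 := mul_le_mul h2 h3 (opNorm_nonneg _) ((opNorm_nonneg _).trans h2)
    have h6 := opNorm_add_le (E - E₀) (((E - E₀) + E₀ + ε⁻¹ • A) * (g - 1))
    rw [← h1] at h6
    change opNorm _ < r
    linarith
  have hle : (η.restrict W₀).map (fun E : Mat d => E * g + ε⁻¹ • (A * g - A)) ≤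
      ENNReal.ofReal 4 • η := by
    rw [hη]
    refine map_restrict_withDensity_le (matLebesgue d) _ hψ
      (isOpen_opNorm_ball E₀ (r / 2)).measurableSet (isOpen_opNorm_ball E₀ r).measurableSet hmaps
      (c₀ := ENNReal.ofReal c) (c₁ := ENNReal.ofReal (4 * c)) ?_ ?_ ?_
    · intro E hE
      have hE' : opNorm (E - E₀) < r / 2 := hE
      exact ENNReal.ofReal_le_ofReal (hφ E (by linarith)).2
    · intro E hE
      exact ENNReal.ofReal_le_ofReal (hφ E hE).1
    · rw [ENNReal.ofReal_mul (by norm_num)]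
  -- Right multiplication by `g` is conjugated to the affine map on the noise variable.
  have hcomp : (fun B : Mat d => B * g) ∘ (fun E : Mat d => A + ε • E) =
      (fun E : Mat d => A + ε • E) ∘ fun E : Mat d => E * g + ε⁻¹ • (A * g - A) := by
    funext E
    simp only [Function.comp_apply, smul_add, smul_smul, mul_inv_cancel₀ hε.ne', one_smul,
      add_mul, smul_mul_assoc]
    abel
  rw [Measure.restrict_map hτ hR, hpre, Measure.map_map hgm hτ, hcomp,
    ← Measure.map_map hτ hψ.measurable, ← Measure.map_smul]
  exact Measure.map_mono hle hτ

/-- A single conditional law may give `R` little mass. The bound is linear in that mass, whose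
average over `F'` is `μ R`. -/
theorem le_fiberAveragedEntropy {d k : ℕ} {F : Subsp d × Subsp d} (hF : F ∈ PF d k)
    {u v : EuclideanSpace ℝ (Fin d)} (h : IsMiniflagFrame F u v) (μ : Measure (Mat d))
    [IsProbabilityMeasure μ] (hμ : ∀ᵐ B ∂μ, IsUnit B) {R : Set (Mat d)} (hR : MeasurableSet R)
    {K : ℝ} (hK : 0 ≤ K) {n : ℕ} (hn : 0 < n)
    (hu : (μ.restrict R).map (fun B => B * unipotent u v (n : ℝ)⁻¹) ≤ ENNReal.ofReal K • μ)
    (hv : (μ.restrict R).map (fun B => B * unipotent v u (n : ℝ)⁻¹) ≤ ENNReal.ofReal K • μ) :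
    ENNReal.ofReal (1 / (800 * (1 + K) * n ^ 2)) * μ R ≤ fiberAveragedEntropy k μ F := by
  have hX := measurable_actPair F
  have hgm : ∀ g : Mat d, Measurable fun B : Mat d => B * g := fun g => by
    have : Continuous fun B : Mat d => B * g := by fun_prop
    exact this.measurable
  rw [← lintegral_condDistrib μ hX hR,
    ← lintegral_const_mul _ (Kernel.measurable_coe _ hR)]
  refine lintegral_mono_ae ?_
  filter_upwards [condDistrib_ae_ae μ hX (measurableSet_isUnit_mat d) hμ,
    condDistrib_restrict_map_le μ hX (hgm _) (h.actPair_mul_unipotent (n : ℝ)⁻¹) hR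
      ENNReal.ofReal_ne_top hu,
    condDistrib_restrict_map_le μ hX (hgm _) (h.symm.actPair_mul_unipotent (n : ℝ)⁻¹) hR
      ENNReal.ofReal_ne_top hv] with F' h1 h2 h3
  have : IsProbabilityMeasure (condDistrib (fun B : Mat d => B) (actPair F) μ F') := inferInstance
  exact le_pushforwardEntropy_actMiniflag hF h _ h1 hK hn h2 h3

end

/-! ### The main theorem: choice of the constants. -/

theorem mainTheorem3 {d : ℕ} (φ : Mat d → ℝ) (hφ_cont : Continuous φ) (hφ_nonneg : ∀ A, 0 ≤ φ A)
    (hφ_decay : ∃ C : ℝ, 0 < C ∧ ∀ A : Mat d, A ≠ 0 → φ A ≤ C / opNorm A ^ (d ^ 2 + 1))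
    (η : Measure (Mat d)) [IsProbabilityMeasure η]
    (hη : η = (matLebesgue d).withDensity fun A => ENNReal.ofReal (φ A)) :
    ∃ Cφ : ℝ, 0 < Cφ ∧
      ∀ M : ℝ, 1 ≤ M → ∀ ε : ℝ, 0 < ε → ε ≤ 1 → ∀ A : Mat d, opNorm A ≤ M →
        ∀ k : ℕ, 1 ≤ k → k < d →
          (∀ᵐ B ∂(η.map fun E => A + ε • E), IsUnit B) ∧
          ENNReal.ofReal (Cφ * ε ^ 2 / M ^ 2) ≤
            uniformFiberwiseEntropy k (η.map fun E => A + ε • E) := by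
  obtain ⟨E₀, c, r, hc, hr, hφ⟩ := exists_bounds_on_opNorm_ball hφ_cont η hη
  have hW : MeasurableSet {E : Mat d | opNorm (E - E₀) < r / 2} :=
    (isOpen_opNorm_ball E₀ (r / 2)).measurableSet
  have hp0 : η {E : Mat d | opNorm (E - E₀) < r / 2} ≠ 0 := by
    have h1 : 0 < ENNReal.ofReal c * matLebesgue d {E : Mat d | opNorm (E - E₀) < r / 2} := by
      refine ENNReal.mul_pos (by simpa using hc) (matLebesgue_pos_of_isOpen
        (isOpen_opNorm_ball E₀ (r / 2)) ⟨E₀, ?_⟩).ne'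
      simp only [Set.mem_ofPred_eq, sub_self, opNorm, map_zero, norm_zero]
      linarith
    refine (h1.trans_le ?_).ne'
    rw [hη, withDensity_apply _ hW, ← setLIntegral_const]
    refine setLIntegral_mono' hW fun E hE => ENNReal.ofReal_le_ofReal (hφ E ?_).1
    have hE' : opNorm (E - E₀) < r / 2 := hE
    linarith
  set p := η.real {E : Mat d | opNorm (E - E₀) < r / 2} with hp
  have hppos : 0 < p := ENNReal.toReal_pos hp0 (measure_ne_top _ _)
  have hE₀ := opNorm_nonneg E₀
  -- Chosen so that `t = 1/n` with `n ≥ L M / ε` meets the displacement bound `t (‖E₀‖ + r + M / ε)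
  -- ≤ r / 2`, using `1 ≤ M / ε`.
  set L := 2 * (opNorm E₀ + r + 1) / r with hL
  have hL1 : 1 ≤ L := by
    rw [hL, le_div_iff₀ hr]
    linarith
  -- Here `16000 = 800 · (1 + 4) · 4`: the domination constant is `K = 4`, and the last factor comes
  -- from `n ≤ 2 L M / ε`.
  refine ⟨p / (16000 * L ^ 2), by positivity, ?_⟩
  intro M hM ε hε hε1 A hA k hk hkd
  have hτ : Measurable fun E : Mat d => A + ε • E := by
    have : Continuous fun E : Mat d => A + ε • E := by fun_prop
    exact this.measurable
  have hunit : ∀ᵐ B ∂(η.map fun E => A + ε • E), IsUnit B := by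
    refine (ae_map_iff hτ.aemeasurable (measurableSet_isUnit_mat d)).2 ?_
    have hac : η ≪ matLebesgue d := by
      rw [hη]
      exact withDensity_absolutelyContinuous _ _
    exact hac.ae_le (ae_isUnit_add_smul A hε.ne')
  refine ⟨hunit, le_iInf₂ fun F hF => ?_⟩
  obtain ⟨u, v, huv⟩ := exists_isMiniflagFrame hF
  have hMε : 1 ≤ M / ε := by
    rw [le_div_iff₀ hε]
    linarith
  have hLM : 1 ≤ L * (M / ε) := by nlinarith
  set n := ⌈L * (M / ε)⌉₊ with hn
  have hn1 : L * (M / ε) ≤ n := Nat.le_ceil _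
  have hn2 : (n : ℝ) ≤ 2 * (L * (M / ε)) := by
    have := Nat.ceil_lt_add_one (zero_le_one.trans hLM)
    linarith
  have hnpos : (0 : ℝ) < n := by linarith
  have hntr : (n : ℝ)⁻¹ * (opNorm E₀ + r + M / ε) ≤ r / 2 := by
    rw [inv_mul_le_iff₀ hnpos]
    have h1 : opNorm E₀ + r + M / ε ≤ (opNorm E₀ + r + 1) * (M / ε) := by nlinarith
    have h2 : L * (M / ε) * (r / 2) = (opNorm E₀ + r + 1) * (M / ε) := by
      rw [hL]
      field_simp
    nlinarith
  have hR : MeasurableSet {B : Mat d | opNorm (ε⁻¹ • (B - A) - E₀) < r / 2} := by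
    have : Continuous fun B : Mat d => ε⁻¹ • (B - A) := by fun_prop
    exact ((isOpen_opNorm_ball E₀ (r / 2)).preimage this).measurableSet
  have hprob : IsProbabilityMeasure (η.map fun E => A + ε • E) :=
    Measure.isProbabilityMeasure_map hτ.aemeasurable
  have hni : (0 : ℝ) ≤ (n : ℝ)⁻¹ := by positivity
  have key := le_fiberAveragedEntropy hF huv (η.map fun E => A + ε • E) hunit hR
    (K := 4) (by norm_num) (n := n) (by exact_mod_cast hnpos)
    (map_restrict_mul_unipotent_le η hη hr hφ hε hni hA hntr huv.norm_left huv.norm_right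
      huv.inner_eq_zero)
    (map_restrict_mul_unipotent_le η hη hr hφ hε hni hA hntr huv.norm_right huv.norm_left
      huv.symm.inner_eq_zero)
  refine le_trans ?_ key
  have hpre : (fun E : Mat d => A + ε • E) ⁻¹' {B | opNorm (ε⁻¹ • (B - A) - E₀) < r / 2} =
      {E : Mat d | opNorm (E - E₀) < r / 2} := by
    ext E
    simp only [Set.mem_preimage, Set.mem_ofPred_eq, add_sub_cancel_left, smul_smul,
      inv_mul_cancel₀ hε.ne', one_smul]
  rw [Measure.map_apply hτ hR, hpre, ← ENNReal.ofReal_toReal (measure_ne_top η _),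
    ← ENNReal.ofReal_mul (by positivity)]
  apply ENNReal.ofReal_le_ofReal
  change _ ≤ 1 / (800 * (1 + 4) * (n : ℝ) ^ 2) * p
  have h5 : (n : ℝ) ^ 2 ≤ 4 * (L * (M / ε)) ^ 2 := by nlinarith
  have h6 : p / (16000 * L ^ 2) * ε ^ 2 / M ^ 2 = 1 / (4000 * (4 * (L * (M / ε)) ^ 2)) * p := by
    field_simp
    norm_num
  rw [h6]
  have h7 : 800 * (1 + 4) * (n : ℝ) ^ 2 ≤ 4000 * (4 * (L * (M / ε)) ^ 2) := by linarith
  gcongr
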